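/- Let $k$ be an algebraically closed field of characteristic $p>3$, let $\mathfrak A=k[X]/(X^p)$, let $D$ be the derivation of $\mathfrak A$ with $DX^i=iX^{i-1}$, and let $\mathfrak g=W_1=\operatorname{Der}_k(\mathfrak A)$ be the Witt algebra, whose $[p]$-map is the $p$-th power of derivations. For $-1\le i\le p-1$ let $\mathfrak g_i=\operatorname{span}_k\{X^{m}D : i+1\le m\le p-1\}$. Let $\mathcal N=\{x\in\mathfrak g : x^{[p]}=0\}$ and $\mathcal C(\mathcal N)=\{(x,y)\in\mathcal N\times\mathcal N : [x,y]=0\}$, with the Zariski topology of $\mathfrak g\times\mathfrak g$. Put $C(0)=\{(x,ax) : x\in\mathcal N,\ a\in k\}$ and, for $1\le i\le p-2$, $C(i)=\{(x,y)\in\mathcal N\times\mathcal N : x\in\mathfrak g_i\setminus\mathfrak g_{i+1},\ [x,y]=0\}$; let $\mathfrak C(i)=\overline{C(i)}$ be the Zariski closure. Then $\mathcal C(\mathcal N)$ is reducible and equidimensional. More precisely, $\mathfrak C(0),\dots,\mathfrak C\big(\tfrac{p-3}{2}\big)$ are pairwise distinct, they are exactly the irreducible components of $\mathcal C(\mathcal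 N)$ (so there are $\tfrac{p-1}{2}$ of them and $\mathcal C(\mathcal N)=\bigcup_{i=0}^{(p-3)/2}\mathfrak C(i)$), and each of them has dimension $p$; in particular $\dim\mathcal C(\mathcal N)=p$. -/

import Mathlib

open Polynomial

noncomputable section

section Zariski

variable (k : Type*) [Field k] (V : Type*) [AddCommGroup V] [Module k V]

/-- The `k`-algebra of polynomial functions on a (finite-dimensional) vector space `V`: the algebra
of functions on `V` generated by the linear forms. -/
def polyFun : Subalgebra k (V → k) :=
  Algebra.adjoin k (Set.range fun φ : Module.Dual k V => (φ : V → k))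

/-- The common zero locus in `V` of a set of functions. -/
def zeroSet (S : Set (V → k)) : Set V := {v | ∀ f ∈ S, f v = 0}

/-- The Zariski topology on a finite-dimensional vector space `V`: the closed sets are the common
zero loci of sets of polynomial functions. -/
@[reducible] def zariskiTopology : TopologicalSpace V :=
  TopologicalSpace.ofClosed
    {Z : Set V | ∃ S : Set (V → k), S ⊆ (polyFun k V : Set (V → k)) ∧ Z = zeroSet k V S}
    ⟨{1}, by
      simp [(polyFun k V).one_mem], by
      ext v; simp [zeroSet]⟩
    (by
      intro 𝒜 h𝒜
      refine ⟨{f | f ∈ polyFun k V ∧ ∃ Z ∈ 𝒜, ∀ v ∈ Z, f v = 0}, fun f hf => hf.1, ?_⟩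
      ext v
      simp only [Set.mem_sInter, zeroSet, Set.mem_ofPred_eq]
      constructor
      · rintro hv f ⟨-, Z, hZ, hf⟩
        exact hf v (hv Z hZ)
      · intro hv Z hZ
        obtain ⟨S, hS, rfl⟩ := h𝒜 hZ
        exact fun f hf => hv f ⟨hS hf, _, hZ, fun w hw => hw f hf⟩)
    (by
      rintro _ ⟨S, hS, rfl⟩ _ ⟨T, hT, rfl⟩
      refine ⟨{h | ∃ f ∈ S, ∃ g ∈ T, h = f * g}, ?_, ?_⟩
      · rintro _ ⟨f, hf, g, hg, rfl⟩
        exact (polyFun k V).mul_mem (hS hf) (hT hg)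
      · ext v
        simp only [zeroSet, Set.mem_union, Set.mem_ofPred_eq]
        constructor
        · rintro (h | h) _ ⟨f, hf, g, hg, rfl⟩
          · simp [h f hf]
          · simp [h g hg]
        · intro h
          by_contra! hc
          obtain ⟨⟨f, hf, hfv⟩, ⟨g, hg, hgv⟩⟩ := hc
          exact mul_ne_zero hfv hgv (h _ ⟨f, hf, g, hg, rfl⟩))

end Zariski

section PthPower

/-- In characteristic `p`, the `p`-th power of a derivation satisfies the Leibniz rule. -/
theorem derivation_pow_char_leibniz {k A : Type*} (p : ℕ) [Fact p.Prime] [Field k] [CharP k p]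
    [CommRing A] [Algebra k A] (x : Derivation k A A) (a b : A) :
    ((x : Module.End k A) ^ p) (a * b)
      = a • ((x : Module.End k A) ^ p) b + b • ((x : Module.End k A) ^ p) a := by
  have key : ∀ (n : ℕ), ((x : Module.End k A) ^ n) (a * b)
      = ∑ m ∈ Finset.HasAntidiagonal.antidiagonal n,
          n.choose m.1 • (((x : Module.End k A) ^ m.1) a * ((x : Module.End k A) ^ m.2) b) := by
    intro n
    induction n with
    | zero => simp
    | succ n ih =>
      rw [pow_succ', Module.End.mul_apply, ih, map_sum,
        Finset.sum_antidiagonal_choose_succ_nsmul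
          (fun i j => ((x : Module.End k A) ^ i) a * ((x : Module.End k A) ^ j) b) n,
        ← Finset.sum_add_distrib]
      refine Finset.sum_congr rfl fun m hm => ?_
      have h : n.choose m.2 = n.choose m.1 := by
        rw [Finset.HasAntidiagonal.mem_antidiagonal] at hm
        exact (Nat.choose_symm_of_eq_add (by omega))
      rw [h, pow_succ', pow_succ', Module.End.mul_apply, Module.End.mul_apply]
      simp only [map_nsmul, Derivation.coeFn_coe, Derivation.leibniz, smul_eq_mul, ← nsmul_add]
      congr 1
      ring
  have hp : p.Prime := Fact.out
  have hpA : (p : A) = 0 := by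
    rw [← map_natCast (algebraMap k A), CharP.cast_eq_zero, map_zero]
  rw [key, Finset.Nat.sum_antidiagonal_eq_sum_range_succ
    (fun i j => p.choose i • (((x : Module.End k A) ^ i) a * ((x : Module.End k A) ^ j) b)),
    Finset.sum_range_succ, ← Nat.succ_pred_eq_of_pos hp.pos, Finset.sum_range_succ',
    Nat.succ_pred_eq_of_pos hp.pos]
  rw [Finset.sum_eq_zero]
  · simp [mul_comm]
  · intro i hi
    rw [Finset.mem_range] at hi
    obtain ⟨c, hc⟩ := hp.dvd_choose_self (Nat.succ_ne_zero i) (by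
      have := Nat.succ_pred_eq_of_pos hp.pos; omega)
    rw [Nat.succ_eq_add_one] at hc
    rw [hc, nsmul_eq_mul, Nat.cast_mul, hpA]
    simp

/-- The `[p]`-map on derivations of an algebra over a field of characteristic `p`: `x^[p]` is the
`p`-fold composite of `x` with itself. -/
def derivationPMap {k A : Type*} (p : ℕ) [Fact p.Prime] [Field k] [CharP k p]
    [CommRing A] [Algebra k A] (x : Derivation k A A) : Derivation k A A :=
  Derivation.mk' ((x : Module.End k A) ^ p) (derivation_pow_char_leibniz p x)

end PthPower

section Witt

variable (k : Type*) [Field k] (p : ℕ)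

/-- The truncated polynomial algebra `k[X]/(X^p)`. -/
abbrev TruncPoly : Type _ := k[X] ⧸ Ideal.span {(X : k[X]) ^ p}

/-- The class of `X` in the truncated polynomial algebra. -/
def truncX : TruncPoly k p := Ideal.Quotient.mk _ X

/-- The Witt algebra: the Lie algebra of derivations of the truncated polynomial algebra. -/
abbrev WittAlg : Type _ := Derivation k (TruncPoly k p) (TruncPoly k p)

/-- In characteristic `p`, the derivation `d/dX` of `k[X]` preserves the ideal `(X^p)`. -/
theorem derivative_mem_span_X_pow [CharP k p] (f : k[X])
    (hf : Ideal.Quotient.mkₐ k (Ideal.span {(X : k[X]) ^ p}) f = 0) :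
    Ideal.Quotient.mkₐ k (Ideal.span {(X : k[X]) ^ p}) (Polynomial.derivative' f) = 0 := by
  simp only [Ideal.Quotient.mkₐ_eq_mk, Ideal.Quotient.eq_zero_iff_mem,
    Ideal.mem_span_singleton] at hf ⊢
  obtain ⟨g, rfl⟩ := hf
  refine ⟨derivative g, ?_⟩
  change derivative (X ^ p * g) = _
  rw [derivative_mul, derivative_X_pow, CharP.cast_eq_zero]
  simp

/-- The derivation `D = d/dX` of the truncated polynomial algebra, `D X^i = i X^(i-1)`. -/
def wittD [CharP k p] : WittAlg k p :=
  Derivation.liftOfSurjective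
    (f := Ideal.Quotient.mkₐ k (Ideal.span {(X : k[X]) ^ p}))
    (Ideal.Quotient.mkₐ_surjective k _)
    (d := Polynomial.derivative')
    (derivative_mem_span_X_pow k p)

/-- The filtration `𝔤_i = span {X^m D | i + 1 ≤ m ≤ p - 1}` of the Witt algebra, `i ≥ -1`; the
element `X^m D` is homogeneous of degree `m - 1`. -/
def wittFil [CharP k p] (i : ℤ) : Submodule k (WittAlg k p) :=
  Submodule.span k {x | ∃ m : ℕ, i + 1 ≤ (m : ℤ) ∧ m ≤ p - 1 ∧ x = truncX k p ^ m • wittD k p}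

/-- The nilpotent variety `{x | x^[p] = 0}` of the Witt algebra. -/
def nilVar [Fact p.Prime] [CharP k p] : Set (WittAlg k p) :=
  {x | derivationPMap p x = 0}

/-- The space of pairs of elements of the Witt algebra, carrying its Zariski topology. -/
def WittPair : Type _ := WittAlg k p × WittAlg k p

instance : TopologicalSpace (WittPair k p) := zariskiTopology k (WittAlg k p × WittAlg k p)

/-- The nilpotent commuting variety, with the (subspace) Zariski topology. -/
def nilCommVar [Fact p.Prime] [CharP k p] : Set (WittPair k p) :=
  {z | z.1 ∈ nilVar k p ∧ z.2 ∈ nilVar k p ∧ ⁅z.1, z.2⁆ = 0}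

/-- For `i = 0`, the set of pairs `(x, a x)` with `x` nilpotent and `a` a scalar; for `1 ≤ i`, the
set of commuting pairs of nilpotent elements whose first entry lies in `𝔤_i` but not
in `𝔤_{i+1}`. -/
def commStratum [Fact p.Prime] [CharP k p] (i : ℕ) : Set (WittPair k p) :=
  if i = 0 then {z | z.1 ∈ nilVar k p ∧ ∃ a : k, z.2 = a • z.1}
  else {z | z.1 ∈ nilVar k p ∧ z.2 ∈ nilVar k p ∧
    z.1 ∈ wittFil k p i ∧ z.1 ∉ wittFil k p (i + 1) ∧ ⁅z.1, z.2⁆ = 0}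

/-- The Zariski closure of the `i`-th stratum. -/
def commClosure [Fact p.Prime] [CharP k p] (i : ℕ) : Set (WittPair k p) :=
  closure (commStratum k p i)

end Witt

end

noncomputable section

/-! ### Polynomial maps, irreducibility and closures in the Zariski topology. -/

section ZariskiGeometry

variable {k : Type*} [Field k]
variable {V : Type*} [AddCommGroup V] [Module k V]
variable {W : Type*} [AddCommGroup W] [Module k W]

/-! Write every element of the Witt algebra as `f D` with `f` in `k[X]/(X^p)`, and let the order of
`f` be the index of its lowest nonzero coefficient; then `𝔤_i` consists of the `f D` with `f` of
order at least `i + 1`. Commutation of `f D` and `g D` means `f g' = g f'`. Comparing coefficients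
shows that if `f` has order `o`, then `g` agrees with a scalar multiple of `f` in all degrees up to
`p - o` (`truncCoeff_eq_zero_of_commute`).

The `i`-th stratum therefore lies in the explicit set `depPairs k p i`: pairs in `𝔤_i` (in `𝒩` when
`i = 0`) that are linearly dependent modulo `𝔤_{p-1-i}`. This set is closed, since dependence is the
vanishing of 2×2 minors, and the stratum is dense in it, because a pair in it can be moved into the
stratum along a line (`commClosure_eq_depPairs`). With `p = 2m + 3`, the sets of index `0, …, m`
cover the commuting variety. A pair with an entry of order at most `m + 1` lies in one of them by
the centralizer computation, order one being excluded by nilpotency. If both orders exceed `m + 1`,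
the pair is dependent modulo `𝔤_{m+2}` because `𝔤_{m+1}/𝔤_{m+2}` is a line.

Each set is the closure of the image of an affine space of dimension `p`, so it is irreducible of
dimension at most `p`. For `i ≥ 1` the map is `(x, a, z) ↦ (x, a x + z)` on `𝔤_i × k × 𝔤_{p-1-i}`.
For `i = 0` it rests on `f D` being nilpotent exactly when the `X^(p-1)` coefficient of `f^(p-1)`
vanishes (`wittEquiv_mem_nilVar_iff`). The map `h ↦ h^(p-1)` on the hyperplane `[X^(p-1)] h = 0`
then reaches every nilpotent `f D` with `f(0) ≠ 0`, and these are dense in `𝒩`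
(`eq_zero_on_nilVar`). Linear subspaces inside the sets give chains of length `p`, and explicit
monomial pairs show that no set contains another. -/

theorem dual_mem_polyFun (φ : Module.Dual k V) : (φ : V → k) ∈ polyFun k V :=
  Algebra.subset_adjoin ⟨φ, rfl⟩

theorem const_mem_polyFun (c : k) : (fun _ : V => c) ∈ polyFun k V :=
  (polyFun k V).algebraMap_mem c

/-- A map between vector spaces is polynomial if its composite with every linear form is a
polynomial function. -/
def IsPolyMap (k : Type*) [Field k] {V W : Type*} [AddCommGroup V] [Module k V] [AddCommGroup W]
    [Module k W] (φ : W → V) : Prop :=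
  ∀ l : Module.Dual k V, (fun w => l (φ w)) ∈ polyFun k W

theorem IsPolyMap.comp_mem {φ : W → V} (hφ : IsPolyMap k φ) {f : V → k} (hf : f ∈ polyFun k V) :
    (fun w => f (φ w)) ∈ polyFun k W := by
  induction hf using Algebra.adjoin_induction with
  | mem f hf => obtain ⟨l, rfl⟩ := hf; exact hφ l
  | algebraMap c => exact const_mem_polyFun c
  | add f g _ _ hf hg => exact (polyFun k W).add_mem hf hg
  | mul f g _ _ hf hg => exact (polyFun k W).mul_mem hf hg

theorem LinearMap.isPolyMap (φ : W →ₗ[k] V) : IsPolyMap k φ := fun l =>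
  dual_mem_polyFun (l.comp φ)

theorem IsPolyMap.add {φ ψ : W → V} (hφ : IsPolyMap k φ) (hψ : IsPolyMap k ψ) :
    IsPolyMap k (fun w => φ w + ψ w) := fun l => by
  convert (polyFun k W).add_mem (hφ l) (hψ l) using 1
  ext w
  simp

theorem IsPolyMap.smul {f : W → k} {φ : W → V} (hf : f ∈ polyFun k W) (hφ : IsPolyMap k φ) :
    IsPolyMap k (fun w => f w • φ w) := fun l => by
  convert (polyFun k W).mul_mem hf (hφ l) using 1
  ext w
  simp

theorem IsPolyMap.prodMk {U : Type*} [AddCommGroup U] [Module k U] {φ : W → V} {ψ : W → U}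
    (hφ : IsPolyMap k φ) (hψ : IsPolyMap k ψ) : IsPolyMap k (fun w => (φ w, ψ w)) := fun l => by
  have h := (polyFun k W).add_mem (hφ (l.comp (LinearMap.inl k V U)))
    (hψ (l.comp (LinearMap.inr k V U)))
  convert h using 1
  ext w
  simp [← map_add]

theorem exists_eval_line {f : V → k} (hf : f ∈ polyFun k V) (u v : V) :
    ∃ P : k[X], ∀ t : k, f (u + t • v) = P.eval t := by
  induction hf using Algebra.adjoin_induction with
  | mem f hf =>
    obtain ⟨l, rfl⟩ := hf
    exact ⟨C (l u) + C (l v) * X, fun t => by simp [mul_comm t]⟩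
  | algebraMap c => exact ⟨C c, fun t => by simp⟩
  | add f g _ _ hf hg =>
    obtain ⟨P, hP⟩ := hf
    obtain ⟨Q, hQ⟩ := hg
    exact ⟨P + Q, fun t => by simp [hP, hQ]⟩
  | mul f g _ _ hf hg =>
    obtain ⟨P, hP⟩ := hf
    obtain ⟨Q, hQ⟩ := hg
    exact ⟨P * Q, fun t => by simp [hP, hQ]⟩

/-- If `f u ≠ 0` and `g v ≠ 0`, restriction to the line through `u` and `v` gives two nonzero
one-variable polynomials with zero product. -/
theorem polyFun_eq_zero_or_eq_zero [Infinite k] {f g : V → k} (hf : f ∈ polyFun k V)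
    (hg : g ∈ polyFun k V) (h : ∀ v, f v * g v = 0) : (∀ v, f v = 0) ∨ ∀ v, g v = 0 := by
  by_contra! hc
  obtain ⟨⟨u, hu⟩, v, hv⟩ := hc
  obtain ⟨P, hP⟩ := exists_eval_line hf u (v - u)
  obtain ⟨Q, hQ⟩ := exists_eval_line hg u (v - u)
  have hPQ : P * Q = 0 := Polynomial.funext fun t => by rw [eval_mul, ← hP, ← hQ, h, eval_zero]
  rcases mul_eq_zero.1 hPQ with h0 | h0
  · apply hu
    have := hP 0
    simpa [h0] using this
  · apply hv
    have := hQ 1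
    simpa [h0] using this

instance [Infinite k] : IsDomain (polyFun k V) :=
  @NoZeroDivisors.to_isDomain _ _ _ ⟨by
    rintro ⟨f, hf⟩ ⟨g, hg⟩ h
    rcases polyFun_eq_zero_or_eq_zero hf hg fun v => congrFun (congrArg Subtype.val h) v with h | h
    · exact Or.inl (Subtype.ext (funext h))
    · exact Or.inr (Subtype.ext (funext h))⟩

/-- A polynomial function agrees, up to a multiple of the linear form `l`, with its composite with
the map `v ↦ v - l v • e`. -/
theorem exists_eq_add_mul_of_dual (l : Module.Dual k V) (e : V) {f : V → k}
    (hf : f ∈ polyFun k V) : ∃ g ∈ polyFun k V, ∀ v, f v = f (v - l v • e) + l v * g v := by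
  induction hf using Algebra.adjoin_induction with
  | mem f hf =>
    obtain ⟨m, rfl⟩ := hf
    exact ⟨fun _ => m e, const_mem_polyFun _, fun v => by simp⟩
  | algebraMap c => exact ⟨0, zero_mem _, fun v => by simp⟩
  | add f g _ _ hf hg =>
    obtain ⟨P, hP, hP'⟩ := hf
    obtain ⟨Q, hQ, hQ'⟩ := hg
    refine ⟨P + Q, add_mem hP hQ, fun v => ?_⟩
    have h1 := hP' v
    have h2 := hQ' v
    simp only [Pi.add_apply]
    linear_combination h1 + h2
  | mul f g hf0 hg0 hf hg =>
    obtain ⟨P, hP, hP'⟩ := hf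
    obtain ⟨Q, hQ, hQ'⟩ := hg
    have hc : (fun v => f (v - l v • e)) ∈ polyFun k V :=
      IsPolyMap.comp_mem (φ := fun v => v - l v • e)
        (LinearMap.isPolyMap (LinearMap.id - l.smulRight e)) hf0
    refine ⟨P * g + (fun v => f (v - l v • e)) * Q, add_mem (mul_mem hP hg0) (mul_mem hc hQ),
      fun v => ?_⟩
    have h1 := hP' v
    have h2 := hQ' v
    simp only [Pi.mul_apply, Pi.add_apply]
    linear_combination (g v) * h1 + f (v - l v • e) * h2

/-- A topological vector space whose closed sets are the common zero loci of polynomial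
functions. -/
class ZariskiSpace (k V : Type*) [Field k] [AddCommGroup V] [Module k V]
    [TopologicalSpace V] : Prop where
  isClosed_iff (Z : Set V) :
    IsClosed Z ↔ ∃ S : Set (V → k), S ⊆ (polyFun k V : Set (V → k)) ∧ Z = zeroSet k V S

theorem zariskiTopology_zariskiSpace (k V : Type*) [Field k] [AddCommGroup V] [Module k V] :
    @ZariskiSpace k V _ _ _ (zariskiTopology k V) := by
  let := zariskiTopology k V
  refine ⟨fun Z => ?_⟩
  rw [← isOpen_compl_iff]
  change Zᶜᶜ ∈ {Z : Set V | ∃ S : Set (V → k), S ⊆ (polyFun k V : Set (V → k)) ∧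
    Z = zeroSet k V S} ↔ _
  rw [compl_compl]
  rfl

variable [TopologicalSpace V] [ZariskiSpace k V]

theorem isClosed_zero_polyFun {f : V → k} (hf : f ∈ polyFun k V) : IsClosed {v | f v = 0} :=
  (ZariskiSpace.isClosed_iff (k := k) _).2 ⟨{f}, by simpa using hf, by simp [zeroSet]⟩

variable (k) in
theorem mem_closure_iff_polyFun {S : Set V} {v : V} :
    v ∈ closure S ↔ ∀ f ∈ polyFun k V, (∀ s ∈ S, f s = 0) → f v = 0 := by
  constructor
  · intro hv f hf hS
    exact closure_minimal (t := {v | f v = 0}) hS (isClosed_zero_polyFun hf) hv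
  · intro h
    obtain ⟨T, hT, hZ⟩ := (ZariskiSpace.isClosed_iff (k := k) _).1 (isClosed_closure (s := S))
    rw [hZ]
    intro f hf
    refine h f (hT hf) fun s hs => ?_
    have := subset_closure hs
    rw [hZ] at this
    exact this f hf

theorem IsPolyMap.continuous [TopologicalSpace W] [ZariskiSpace k W] {φ : W → V} (hφ : IsPolyMap k φ) : Continuous φ := by
  rw [continuous_iff_isClosed]
  intro Z hZ
  obtain ⟨S, hS, rfl⟩ := (ZariskiSpace.isClosed_iff (k := k) _).1 hZ
  rw [ZariskiSpace.isClosed_iff (k := k)]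
  refine ⟨(fun f w => f (φ w)) '' S, ?_, ?_⟩
  · rintro _ ⟨f, hf, rfl⟩
    exact hφ.comp_mem (hS hf)
  · ext w
    simp [zeroSet]

variable (k) in
theorem isIrreducible_univ_of_zariskiSpace [Infinite k] : IsIrreducible (Set.univ : Set V) := by
  refine ⟨Set.univ_nonempty, ?_⟩
  rw [isPreirreducible_iff_isClosed_union_isClosed]
  intro A B hA hB hAB
  by_contra! hc
  rw [Set.not_subset, Set.not_subset] at hc
  obtain ⟨⟨a, -, ha⟩, b, -, hb⟩ := hc
  obtain ⟨S, hS, rfl⟩ := (ZariskiSpace.isClosed_iff (k := k) _).1 hA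
  obtain ⟨T, hT, rfl⟩ := (ZariskiSpace.isClosed_iff (k := k) _).1 hB
  simp only [zeroSet, Set.mem_ofPred_eq, not_forall] at ha hb
  obtain ⟨f, hf, hfa⟩ := ha
  obtain ⟨g, hg, hgb⟩ := hb
  have hfg (v : V) : f v * g v = 0 := by
    rcases hAB (Set.mem_univ v) with h | h
    · rw [h f hf, zero_mul]
    · rw [h g hg, mul_zero]
  rcases polyFun_eq_zero_or_eq_zero (hS hf) (hT hg) hfg with h | h
  · exact hfa (h a)
  · exact hgb (h b)

theorem IsPolyMap.isIrreducible_range [Infinite k] {φ : W → V} (hφ : IsPolyMap k φ) :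
    IsIrreducible (Set.range φ) := by
  let := zariskiTopology k W
  have := zariskiTopology_zariskiSpace k W
  rw [← Set.image_univ]
  exact (isIrreducible_univ_of_zariskiSpace k).image φ hφ.continuous.continuousOn

variable (k) in
/-- A closed set containing a punctured line contains the whole line. -/
theorem mem_of_forall_line_mem [Infinite k] {Z : Set V} (hZ : IsClosed Z) (u v : V)
    (h : ∀ t : k, t ≠ 0 → u + t • v ∈ Z) : u ∈ Z := by
  rw [← hZ.closure_eq, mem_closure_iff_polyFun k]
  intro f hf hfZ
  obtain ⟨P, hP⟩ := exists_eval_line hf u v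
  have hXP : X * P = 0 := Polynomial.funext fun t => by
    rw [eval_mul, eval_X, eval_zero, ← hP]
    by_cases ht : t = 0
    · simp [ht]
    · rw [hfZ _ (h t ht), mul_zero]
  have hP0 : P = 0 := (mul_eq_zero.1 hXP).resolve_left X_ne_zero
  have := hP 0
  simpa [hP0] using this

variable (k) in
theorem Submodule.isClosed_of_zariskiSpace (L : Submodule k V) : IsClosed (L : Set V) := by
  have : (L : Set V) = ⋂ l ∈ L.dualAnnihilator, {v | (l : Module.Dual k V) v = 0} := by
    ext v
    simp only [SetLike.mem_coe, Set.mem_iInter, Set.mem_ofPred_eq]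
    conv_lhs => rw [← Subspace.dualAnnihilator_dualCoannihilator_eq (W := L)]
    rw [Submodule.mem_dualCoannihilator]
  rw [this]
  exact isClosed_biInter fun l _ => isClosed_zero_polyFun (k := k) (dual_mem_polyFun l)

variable (k) in
theorem Submodule.isIrreducible_of_zariskiSpace [Infinite k] (L : Submodule k V) :
    IsIrreducible (L : Set V) := by
  have := (LinearMap.isPolyMap L.subtype).isIrreducible_range
  simpa using this

end ZariskiGeometry

/-! ### Upper and lower bounds for Krull dimension. -/

section ZariskiDimension

variable {k : Type*} [Field k]
variable {V : Type*} [AddCommGroup V] [Module k V]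
variable {W : Type*} [AddCommGroup W] [Module k W]

theorem exists_surjective_mvPolynomial_polyFun (k V : Type*) [Field k] [AddCommGroup V] [Module k V]
    [FiniteDimensional k V] :
    ∃ F : MvPolynomial (Fin (Module.finrank k V)) k →ₐ[k] polyFun k V, Function.Surjective F := by
  let b := Module.finBasis k V
  let F : MvPolynomial (Fin (Module.finrank k V)) k →ₐ[k] polyFun k V :=
    MvPolynomial.aeval fun i => ⟨b.coord i, dual_mem_polyFun _⟩
  refine ⟨F, fun f => ?_⟩
  have hle : polyFun k V ≤ ((polyFun k V).val.comp F).range := by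
    refine Algebra.adjoin_le ?_
    rintro _ ⟨l, rfl⟩
    refine ⟨∑ i, MvPolynomial.C (l (b i)) * MvPolynomial.X i, ?_⟩
    ext v
    have h := congrArg l (b.sum_repr v)
    simp only [map_sum, map_smul, smul_eq_mul] at h
    simpa [F, MvPolynomial.algHom_C, mul_comm, Finset.sum_apply] using h
  obtain ⟨P, hP⟩ := hle f.2
  exact ⟨P, Subtype.ext hP⟩

theorem finiteType_polyFun [FiniteDimensional k V] : Algebra.FiniteType k (polyFun k V) := by
  obtain ⟨F, hF⟩ := exists_surjective_mvPolynomial_polyFun k V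
  exact Algebra.FiniteType.of_surjective F hF

/-- Comparison of transcendence degrees: `polyFun k W` is a quotient of a polynomial ring in
`finrank k W` variables. -/
theorem natCast_le_finrank_of_injective [FiniteDimensional k W] {s : ℕ}
    (g : MvPolynomial (Fin s) k →ₐ[k] polyFun k W) (hg : Function.Injective g) :
    s ≤ Module.finrank k W := by
  obtain ⟨F, hF⟩ := exists_surjective_mvPolynomial_polyFun k W
  have h1 := lift_trdeg_le_of_injective g hg
  have h2 := lift_trdeg_le_of_surjective F hF
  simp only [MvPolynomial.trdeg_of_isDomain, Cardinal.mk_fin, Cardinal.lift_natCast] at h1 h2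
  have h3 := h1.trans (Cardinal.lift_le.2 (Cardinal.lift_le.1 (h2.trans (Cardinal.lift_natCast _).ge)))
  simpa using h3

/-- The irreducible closed subsets of a space embed into the spectrum of any algebra of functions
whose zero loci are the closed sets. -/
theorem topologicalKrullDim_le_ringKrullDim {Z : Type*} [TopologicalSpace Z]
    {R : Type*} [CommRing R] (ev : R →+* (Z → k))
    (hev : ∀ r, IsClosed {z | ev r z = 0})
    (hZ : ∀ T : Set Z, IsClosed T → ∀ z, (∀ r, (∀ t ∈ T, ev r t = 0) → ev r z = 0) → z ∈ T) :
    topologicalKrullDim Z ≤ ringKrullDim R := by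
  let I (T : TopologicalSpace.IrreducibleCloseds Z) : Ideal R :=
    { carrier := {r | ∀ t ∈ T.1, ev r t = 0}
      add_mem' := fun {a b} ha hb t ht => by simp [ha t ht, hb t ht]
      zero_mem' := fun t _ => by simp
      smul_mem' := fun a b hb t ht => by simp [hb t ht] }
  have hI (T : TopologicalSpace.IrreducibleCloseds Z) : (I T).IsPrime := by
    refine ⟨?_, ?_⟩
    · rw [Ideal.ne_top_iff_one]
      intro h1
      obtain ⟨t, ht⟩ := T.2.1
      have := h1 t ht
      simp at this
    · intro a b hab
      have h := isPreirreducible_iff_isClosed_union_isClosed.1 T.2.2 _ _ (hev a) (hev b)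
        fun t ht => by
          have := hab t ht
          simpa [map_mul] using this
      exact h
  let Φ (T : (TopologicalSpace.IrreducibleCloseds Z)) : (PrimeSpectrum R)ᵒᵈ :=
    OrderDual.toDual ⟨I T, hI T⟩
  have hΦ : StrictMono Φ := by
    intro S T hST
    rw [lt_iff_le_not_ge] at hST ⊢
    refine ⟨fun r hr t ht => hr t (hST.1 ht), fun h => hST.2 fun t ht => ?_⟩
    exact hZ S.1 S.3 t fun r hr => h hr t ht
  exact (Order.krullDim_le_of_strictMono Φ hΦ).trans Order.krullDim_orderDual.le

/-- Noether normalization makes `R` integral over a polynomial ring in `s` variables.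
Incomparability of primes bounds the dimension of `R` by `s`, and `s` is bounded through the
embedding into `polyFun k W`. -/
theorem ringKrullDim_le_of_injective_polyFun [Infinite k] [FiniteDimensional k W] {R : Type*}
    [CommRing R] [Algebra k R] [Algebra.FiniteType k R] (ψ : R →ₐ[k] polyFun k W)
    (hψ : Function.Injective ψ) : ringKrullDim R ≤ Module.finrank k W := by
  have : Nontrivial R := ψ.toRingHom.domain_nontrivial
  obtain ⟨s, g, hg, hgi⟩ := exists_integral_inj_algHom_of_fg k R
  have hs : s ≤ Module.finrank k W :=
    natCast_le_finrank_of_injective (ψ.comp g) (hψ.comp hg)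
  have h1 : ringKrullDim R ≤ ringKrullDim (MvPolynomial (Fin s) k) := by
    algebraize [g.toRingHom]
    refine Order.krullDim_le_of_strictMono
      (PrimeSpectrum.comap (algebraMap (MvPolynomial (Fin s) k) R)) ?_
    intro P Q hPQ
    have := P.2
    exact Ideal.IsIntegral.comap_lt_comap (R := MvPolynomial (Fin s) k) hPQ
  have h2 : ringKrullDim (MvPolynomial (Fin s) k) = s := by
    rw [MvPolynomial.ringKrullDim_of_isNoetherianRing, ringKrullDim_eq_zero_of_field]
    simp
  exact (h1.trans h2.le).trans (by exact_mod_cast hs)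

variable [TopologicalSpace V] [ZariskiSpace k V]

/-- The closure of the image of an affine space under a polynomial map has at most the dimension
of that affine space. -/
theorem IsPolyMap.topologicalKrullDim_closure_range_le [Infinite k] [FiniteDimensional k V]
    [FiniteDimensional k W] {φ : W → V} (hφ : IsPolyMap k φ) :
    topologicalKrullDim (closure (Set.range φ)) ≤ Module.finrank k W := by
  set Z := closure (Set.range φ)
  -- The range of `res` is the coordinate ring of the closure `Z`. It embeds into `polyFun k W` by
  -- pullback along `φ`, since a function vanishing on the image vanishes on `Z`.
  let res : polyFun k V →ₐ[k] (Z → k) :=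
    (AlgHom.pi fun z : Z => Pi.evalAlgHom k (fun _ : V => k) z.1).comp (polyFun k V).val
  have hfin := finiteType_polyFun (k := k) (V := V)
  have : Algebra.FiniteType k res.range :=
    Algebra.FiniteType.of_surjective res.rangeRestrict res.rangeRestrict_surjective
  have hsub (w : W) : φ w ∈ Z := subset_closure ⟨w, rfl⟩
  let pull : (Z → k) →ₐ[k] (W → k) :=
    AlgHom.pi fun w : W => Pi.evalAlgHom k (fun _ : Z => k) ⟨φ w, hsub w⟩
  let ψ : res.range →ₐ[k] polyFun k W := (pull.comp res.range.val).codRestrict (polyFun k W) (by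
    rintro ⟨_, f, rfl⟩
    exact hφ.comp_mem f.2)
  have hψ : Function.Injective ψ := by
    rw [injective_iff_map_eq_zero]
    rintro ⟨_, f, rfl⟩ h
    refine Subtype.ext (funext fun z => ?_)
    refine (mem_closure_iff_polyFun k).1 z.2 f.1 f.2 ?_
    rintro _ ⟨w, rfl⟩
    exact congrFun (congrArg Subtype.val h) w
  refine (topologicalKrullDim_le_ringKrullDim (k := k) res.range.val.toRingHom ?_ ?_).trans
    (ringKrullDim_le_of_injective_polyFun ψ hψ)
  · rintro ⟨_, f, rfl⟩
    exact (isClosed_zero_polyFun f.2).preimage continuous_subtype_val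
  · intro T hT z hz
    have hzc : z ∈ closure T := by
      rw [closure_subtype, mem_closure_iff_polyFun k]
      intro f hf hfT
      refine hz ⟨_, ⟨f, hf⟩, rfl⟩ fun t ht => ?_
      exact hfT _ ⟨t, ht, rfl⟩
    rwa [hT.closure_eq] at hzc

/-- A chain in `T` becomes a chain in `Z` by taking closures. The whole irreducible space `Z` can be
added on top because the closed proper subset `T` contains every earlier member. -/
theorem add_one_le_topologicalKrullDim {X : Type*} [TopologicalSpace X] {T Z : Set X}
    (hT : IsClosed T) (hTZ : T ⊂ Z) (hZ : IsIrreducible Z) {n : ℕ}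
    (hn : (n : WithBot ℕ∞) ≤ topologicalKrullDim T) :
    ((n + 1 : ℕ) : WithBot ℕ∞) ≤ topologicalKrullDim Z := by
  obtain ⟨s, hs⟩ := Order.le_krullDim_iff.1 hn
  let j : T → Z := Set.inclusion hTZ.1
  have hj : Topology.IsInducing j := (Topology.IsEmbedding.inclusion hTZ.1).isInducing
  let e := TopologicalSpace.IrreducibleCloseds.map j hj.continuous
  have he : StrictMono e := TopologicalSpace.IrreducibleCloseds.map_strictMono_of_isInducing hj
  have hir := Subtype.irreducibleSpace hZ
  let top : TopologicalSpace.IrreducibleCloseds Z :=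
    ⟨Set.univ, hir.isIrreducible_univ, isClosed_univ⟩
  have hlast : (s.map e he).last < top := by
    rw [LTSeries.last_map, lt_iff_le_not_ge]
    refine ⟨fun x _ => Set.mem_univ x, fun h => ?_⟩
    obtain ⟨x, hxZ, hxT⟩ := Set.exists_of_ssubset hTZ
    have hx : (⟨x, hxZ⟩ : Z) ∈ closure (j '' (s.last : Set T)) := h (Set.mem_univ _)
    have hcl : IsClosed ((Subtype.val : Z → X) ⁻¹' T) := hT.preimage continuous_subtype_val
    refine hxT (closure_minimal ?_ hcl hx)
    rintro _ ⟨t, -, rfl⟩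
    exact t.2
  exact Order.le_krullDim_iff.2 ⟨(s.map e he).snoc top hlast, by simp [hs]⟩

/-- A complete flag of subspaces is a chain of irreducible closed sets. -/
theorem finrank_le_topologicalKrullDim [Infinite k] [FiniteDimensional k V] (n : ℕ)
    (L : Submodule k V) (hL : Module.finrank k L = n) :
    (n : WithBot ℕ∞) ≤ topologicalKrullDim (L : Set V) := by
  induction n generalizing L with
  | zero =>
    have : Nonempty (L : Set V) := ⟨⟨0, L.zero_mem⟩⟩
    have hir := Subtype.irreducibleSpace (L.isIrreducible_of_zariskiSpace k)
    have : Nonempty (TopologicalSpace.IrreducibleCloseds (L : Set V)) :=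
      ⟨⟨Set.univ, hir.isIrreducible_univ, isClosed_univ⟩⟩
    exact Order.krullDim_nonneg
  | succ n ih =>
    obtain ⟨M, hML, hM⟩ : ∃ M : Submodule k V, M < L ∧ Module.finrank k M = n := by
      obtain ⟨f, hf⟩ := exists_linearIndependent_of_le_finrank (R := k) (M := L) (n := n) (by omega)
      have h := finrank_span_eq_card hf
      rw [Fintype.card_fin] at h
      refine ⟨(Submodule.span k (Set.range f)).map L.subtype, ?_, ?_⟩
      · refine lt_of_le_of_ne (Submodule.map_subtype_le _ _) fun heq => ?_
        have := (LinearEquiv.finrank_eq (Submodule.equivSubtypeMap L (Submodule.span k (Set.range f))))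
        rw [heq] at this
        omega
      · rw [← LinearEquiv.finrank_eq
          (Submodule.equivSubtypeMap L (Submodule.span k (Set.range f))), h]
    exact add_one_le_topologicalKrullDim (M.isClosed_of_zariskiSpace k)
      (SetLike.coe_ssubset_coe.2 hML) (L.isIrreducible_of_zariskiSpace k) (ih M hM)

end ZariskiDimension

/-! ### Components and dimension of a finite union of irreducible closed sets. -/

section IrreducibleCover

variable {X : Type*} [TopologicalSpace X]

theorem IsIrreducible.preimage_subtypeVal {A B : Set X} (hA : IsIrreducible A) (hAB : A ⊆ B) :
    IsIrreducible ((Subtype.val : B → X) ⁻¹' A) := by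
  have := Subtype.irreducibleSpace hA
  have h : (Subtype.val : B → X) ⁻¹' A = Set.inclusion hAB '' Set.univ := by
    rw [Set.image_univ, Set.range_inclusion]
    rfl
  rw [h]
  exact (IrreducibleSpace.isIrreducible_univ A).image _ (continuous_inclusion hAB).continuousOn

theorem IsIrreducible.exists_subset_of_subset_biUnion {s : Finset ℕ} {E : ℕ → Set X}
    (hcl : ∀ i ∈ s, IsClosed (E i)) {T : Set X} (hT : IsIrreducible T)
    (hTE : T ⊆ ⋃ i ∈ s, E i) : ∃ i ∈ s, T ⊆ E i := by
  classical
  obtain ⟨z, hz, hTz⟩ := isIrreducible_iff_sUnion_isClosed.1 hT (s.image E)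
    (by simpa using hcl) (by simpa [Set.sUnion_image] using hTE)
  obtain ⟨i, hi, rfl⟩ := Finset.mem_image.1 hz
  exact ⟨i, hi, hTz⟩

variable {s : Finset ℕ} {E : ℕ → Set X}

/-- Every irreducible subset of `Y` lies in a single piece, so the absence of inclusions between
pieces makes them exactly the maximal irreducible subsets. -/
theorem image_irreducibleComponents_biUnion (hcl : ∀ i ∈ s, IsClosed (E i))
    (hirr : ∀ i ∈ s, IsIrreducible (E i))
    (hinc : ∀ i ∈ s, ∀ j ∈ s, E i ⊆ E j → i = j) {Y : Set X} (hY : Y = ⋃ i ∈ s, E i) :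
    (fun Z : Set Y => (Subtype.val '' Z : Set X)) '' irreducibleComponents Y = E '' s := by
  have hEY (i : ℕ) (hi : i ∈ s) : E i ⊆ Y := hY ▸ Set.subset_biUnion_of_mem (u := E) hi
  have hcover (T : Set Y) (hT : IsIrreducible T) : ∃ i ∈ s, Subtype.val '' T ⊆ E i := by
    refine (hT.image Subtype.val continuous_subtype_val.continuousOn).exists_subset_of_subset_biUnion
      hcl ?_
    rw [← hY]
    exact Subtype.coe_image_subset _ _
  have himage (i : ℕ) (hi : i ∈ s) :
      (Subtype.val '' ((Subtype.val : Y → X) ⁻¹' E i) : Set X) = E i := by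
    rw [Subtype.image_preimage_coe, Set.inter_eq_right]
    exact hEY i hi
  ext A
  constructor
  · rintro ⟨Z, hZ, rfl⟩
    obtain ⟨i, hi, hZi⟩ := hcover Z hZ.1
    refine ⟨i, hi, ?_⟩
    have h1 : Z ≤ (Subtype.val : Y → X) ⁻¹' E i := Set.image_subset_iff.1 hZi
    have h2 := hZ.2 ((hirr i hi).preimage_subtypeVal (hEY i hi)) h1
    dsimp only
    rw [Set.Subset.antisymm h1 h2, himage i hi]
  · rintro ⟨i, hi, rfl⟩
    refine ⟨(Subtype.val : Y → X) ⁻¹' E i, ⟨(hirr i hi).preimage_subtypeVal (hEY i hi), ?_⟩,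
      himage i hi⟩
    intro T hT hiT
    obtain ⟨j, hj, hTj⟩ := hcover T hT
    have hij : E i ⊆ E j := by
      rw [← himage i hi]
      exact (Set.image_mono hiT).trans hTj
    obtain rfl := hinc i hi j hj hij
    exact Set.image_subset_iff.1 hTj

/-- The largest member of a chain is irreducible, so it lies in a single `E i`, and the whole chain
lies there with it. -/
theorem topologicalKrullDim_biUnion_le (hcl : ∀ i ∈ s, IsClosed (E i)) {Y : Set X}
    (hY : Y = ⋃ i ∈ s, E i) {n : WithBot ℕ∞} (hn : ∀ i ∈ s, topologicalKrullDim (E i) ≤ n) :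
    topologicalKrullDim Y ≤ n := by
  refine iSup_le fun c => ?_
  obtain ⟨i, hi, hci⟩ : ∃ i ∈ s, Subtype.val '' (c.last : Set Y) ⊆ E i := by
    refine (c.last.2.image Subtype.val
      continuous_subtype_val.continuousOn).exists_subset_of_subset_biUnion hcl ?_
    rw [← hY]
    exact Subtype.coe_image_subset _ _
  have hle (j : Fin (c.length + 1)) : Subtype.val '' (c j : Set Y) ⊆ E i :=
    (Set.image_mono (LTSeries.monotone c (Fin.le_last j))).trans hci
  have hiY : E i ⊆ Y := hY ▸ Set.subset_biUnion_of_mem (u := E) hi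
  have heq (T : Set Y) : (Subtype.val : E i → X) ⁻¹' (Subtype.val '' T) =
      Set.inclusion hiY ⁻¹' T := by
    ext x
    constructor
    · rintro ⟨y, hy, hyx⟩
      have : Set.inclusion hiY x = y := Subtype.ext hyx.symm
      rwa [Set.mem_preimage, this]
    · exact fun hx => ⟨_, hx, rfl⟩
  let f (j : Fin (c.length + 1)) : TopologicalSpace.IrreducibleCloseds (E i) :=
    ⟨(Subtype.val : E i → X) ⁻¹' (Subtype.val '' (c j : Set Y)),
      ((c j).2.image Subtype.val continuous_subtype_val.continuousOn).preimage_subtypeVal (hle j), by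
        rw [heq]
        exact (c j).3.preimage (continuous_inclusion hiY)⟩
  have hf : StrictMono f := by
    intro a b hab
    have h := LTSeries.strictMono c hab
    rw [lt_iff_le_not_ge] at h ⊢
    refine ⟨fun x hx => Set.image_mono h.1 hx, fun hba => h.2 fun y hy => ?_⟩
    have hyi : (y : X) ∈ E i := hle b ⟨y, hy, rfl⟩
    obtain ⟨y', hy', h'⟩ := hba (show (⟨y, hyi⟩ : E i) ∈ f b from ⟨y, hy, rfl⟩)
    rwa [← Subtype.ext h']
  let d : LTSeries (TopologicalSpace.IrreducibleCloseds (E i)) := LTSeries.mk c.length f hf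
  exact (le_iSup (fun p : LTSeries (TopologicalSpace.IrreducibleCloseds (E i)) =>
    (p.length : WithBot ℕ∞)) d).trans (hn i hi)

theorem topologicalKrullDim_image_subtypeVal {Y : Set X} (Z : Set Y) :
    topologicalKrullDim (Subtype.val '' Z : Set X) = topologicalKrullDim Z :=
  (IsHomeomorph.topologicalKrullDim_eq _
    (Topology.IsEmbedding.subtypeVal.homeomorphImage Z).isHomeomorph).symm

end IrreducibleCover

/-! ### Coefficients, Frobenius and differentiation in `k[X]/(X^p)`. -/

section TruncatedPolynomials

variable (k : Type*) [Field k] (p : ℕ)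

/-- The coefficient of `X^n` in the truncated polynomial algebra (zero for `n ≥ p`). -/
def truncCoeff (n : ℕ) : TruncPoly k p →ₗ[k] k :=
  Submodule.liftQ ((Ideal.span {(X : k[X]) ^ p}).restrictScalars k)
    (if n < p then lcoeff k n else 0) (by
      intro f hf
      rw [Submodule.restrictScalars_mem, Ideal.mem_span_singleton, X_pow_dvd_iff] at hf
      by_cases hn : n < p
      · simp [hn, hf n hn]
      · simp [hn])

/-- The element of the truncated polynomial algebra with the given coefficients. -/
def truncOfCoeff (c : ℕ → k) : TruncPoly k p :=
  Ideal.Quotient.mk _ (∑ j ∈ Finset.range p, C (c j) * X ^ j)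

variable {k p}

theorem truncCoeff_mk (n : ℕ) (f : k[X]) :
    truncCoeff k p n (Ideal.Quotient.mk _ f) = if n < p then f.coeff n else 0 := by
  change (if n < p then lcoeff k n else 0 : k[X] →ₗ[k] k) f = _
  split_ifs <;> rfl

theorem truncCoeff_of_le {n : ℕ} (hn : p ≤ n) (a : TruncPoly k p) : truncCoeff k p n a = 0 := by
  obtain ⟨f, rfl⟩ := Ideal.Quotient.mk_surjective a
  rw [truncCoeff_mk, if_neg (by omega)]

theorem truncCoeff_truncOfCoeff (c : ℕ → k) (n : ℕ) :
    truncCoeff k p n (truncOfCoeff k p c) = if n < p then c n else 0 := by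
  rw [truncOfCoeff, truncCoeff_mk]
  split_ifs with h
  · simp [coeff_X_pow, h]
  · rfl

theorem truncPoly_ext {a b : TruncPoly k p}
    (h : ∀ n < p, truncCoeff k p n a = truncCoeff k p n b) : a = b := by
  obtain ⟨f, rfl⟩ := Ideal.Quotient.mk_surjective a
  obtain ⟨g, rfl⟩ := Ideal.Quotient.mk_surjective b
  rw [Ideal.Quotient.eq, Ideal.mem_span_singleton, X_pow_dvd_iff]
  intro n hn
  have := h n hn
  rw [truncCoeff_mk, truncCoeff_mk, if_pos hn, if_pos hn] at this
  rw [coeff_sub, this, sub_self]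

theorem truncCoeff_mul {n : ℕ} (hn : n < p) (a b : TruncPoly k p) :
    truncCoeff k p n (a * b) =
      ∑ m ∈ Finset.HasAntidiagonal.antidiagonal n, truncCoeff k p m.1 a * truncCoeff k p m.2 b := by
  obtain ⟨f, rfl⟩ := Ideal.Quotient.mk_surjective a
  obtain ⟨g, rfl⟩ := Ideal.Quotient.mk_surjective b
  rw [← map_mul, truncCoeff_mk, if_pos hn, coeff_mul]
  refine Finset.sum_congr rfl fun m hm => ?_
  rw [Finset.HasAntidiagonal.mem_antidiagonal] at hm
  rw [truncCoeff_mk, truncCoeff_mk, if_pos (by omega), if_pos (by omega)]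

theorem truncCoeff_algebraMap [NeZero p] (n : ℕ) (c : k) :
    truncCoeff k p n (algebraMap k _ c) = if n = 0 then c else 0 := by
  have hp : 0 < p := NeZero.pos p
  change truncCoeff k p n (Ideal.Quotient.mk _ (C c)) = _
  rw [truncCoeff_mk, coeff_C]
  split_ifs <;> first | rfl | omega

theorem truncCoeff_truncX_pow_mul {n : ℕ} (hn : n < p) (m : ℕ) (a : TruncPoly k p) :
    truncCoeff k p n (truncX k p ^ m * a) = if m ≤ n then truncCoeff k p (n - m) a else 0 := by
  obtain ⟨f, rfl⟩ := Ideal.Quotient.mk_surjective a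
  rw [truncX, ← map_pow, ← map_mul, truncCoeff_mk, if_pos hn, coeff_X_pow_mul']
  split_ifs with h
  · rw [truncCoeff_mk, if_pos (by omega)]
  · rfl

theorem truncCoeff_truncX_pow (n m : ℕ) :
    truncCoeff k p n (truncX k p ^ m) = if n < p ∧ n = m then 1 else 0 := by
  rw [truncX, ← map_pow, truncCoeff_mk, coeff_X_pow]
  split_ifs <;> first | rfl | omega

theorem truncCoeff_zero_mul [NeZero p] (a b : TruncPoly k p) :
    truncCoeff k p 0 (a * b) = truncCoeff k p 0 a * truncCoeff k p 0 b := by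
  rw [truncCoeff_mul (NeZero.pos p)]
  simp

theorem truncCoeff_zero_pow [NeZero p] (a : TruncPoly k p) (n : ℕ) :
    truncCoeff k p 0 (a ^ n) = truncCoeff k p 0 a ^ n := by
  induction n with
  | zero => simpa using truncCoeff_algebraMap (k := k) (p := p) 0 1
  | succ n ih => rw [pow_succ, truncCoeff_zero_mul, ih, pow_succ]

theorem exists_eq_truncX_pow_mul {m : ℕ} (hm : m ≤ p) {a : TruncPoly k p}
    (ha : ∀ j < m, truncCoeff k p j a = 0) :
    ∃ b, a = truncX k p ^ m * b := by
  obtain ⟨f, rfl⟩ := Ideal.Quotient.mk_surjective a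
  obtain ⟨g, rfl⟩ : X ^ m ∣ f := X_pow_dvd_iff.2 fun j hj => by
    have := ha j hj
    rwa [truncCoeff_mk, if_pos (by omega)] at this
  exact ⟨Ideal.Quotient.mk _ g, by rw [map_mul, map_pow]; rfl⟩

theorem truncX_pow_eq_zero {m : ℕ} (hm : p ≤ m) : truncX k p ^ m = 0 := by
  refine truncPoly_ext fun n hn => ?_
  rw [truncCoeff_truncX_pow, if_neg (by omega), map_zero]

theorem adjoin_truncX : Algebra.adjoin k {truncX k p} = ⊤ := by
  have h := congrArg (Subalgebra.map (Ideal.Quotient.mkₐ k (Ideal.span {(X : k[X]) ^ p})))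
    (Polynomial.adjoin_X (R := k))
  rw [AlgHom.map_adjoin, Algebra.map_top,
    (AlgHom.range_eq_top _).2 (Ideal.Quotient.mkₐ_surjective k _), Set.image_singleton] at h
  exact h

variable (k p) in
/-- The coordinates on the truncated polynomial algebra. -/
def truncEquiv : TruncPoly k p ≃ₗ[k] (Fin p → k) :=
  LinearEquiv.ofBijective (LinearMap.pi fun i : Fin p => truncCoeff k p i) ⟨fun a b h =>
    truncPoly_ext fun n hn => congrFun h ⟨n, hn⟩, fun c =>
    ⟨truncOfCoeff k p (fun n : ℕ => if h : n < p then c ⟨n, h⟩ else 0), by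
      funext i
      simp [truncCoeff_truncOfCoeff]⟩⟩

instance : FiniteDimensional k (TruncPoly k p) := (truncEquiv k p).symm.finiteDimensional

instance [Fact p.Prime] [CharP k p] : CharP (TruncPoly k p) p := by
  have : Nontrivial (TruncPoly k p) :=
    ⟨1, 0, fun h => by
      have := congrArg (truncCoeff k p 0) h
      have hp : p ≠ 0 := (Fact.out : p.Prime).ne_zero
      have := truncCoeff_truncX_pow (k := k) (p := p) 0 0
      simp_all [Nat.pos_of_ne_zero]⟩
  exact charP_of_injective_algebraMap (algebraMap k (TruncPoly k p)).injective p

/-- Frobenius is additive and kills the multiples of `X`, so only the constant term survives. -/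
theorem truncPoly_pow_char [Fact p.Prime] [CharP k p] (a : TruncPoly k p) :
    a ^ p = algebraMap k _ (truncCoeff k p 0 a ^ p) := by
  have hp : p.Prime := Fact.out
  obtain ⟨b, hb⟩ := exists_eq_truncX_pow_mul (m := 1) hp.one_lt.le
    (a := a - algebraMap k _ (truncCoeff k p 0 a)) fun j hj => by
      obtain rfl : j = 0 := by omega
      rw [map_sub, truncCoeff_algebraMap, if_pos rfl, sub_self]
  rw [sub_eq_iff_eq_add] at hb
  conv_lhs => rw [hb]
  rw [add_pow_char, mul_pow, ← pow_mul, truncX_pow_eq_zero (by omega), zero_mul, zero_add, map_pow]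

variable [CharP k p]

theorem wittD_mk (f : k[X]) :
    wittD k p (Ideal.Quotient.mk _ f) = Ideal.Quotient.mk _ (derivative f) :=
  Derivation.liftOfSurjective_apply (Ideal.Quotient.mkₐ_surjective k _)
    (derivative_mem_span_X_pow k p) f

theorem wittD_truncX : wittD k p (truncX k p) = 1 := by
  rw [truncX, wittD_mk, derivative_X, map_one]

theorem truncCoeff_wittD (n : ℕ) (a : TruncPoly k p) :
    truncCoeff k p n (wittD k p a) = (n + 1) * truncCoeff k p (n + 1) a := by
  obtain ⟨f, rfl⟩ := Ideal.Quotient.mk_surjective a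
  rw [wittD_mk, truncCoeff_mk, truncCoeff_mk, coeff_derivative, mul_comm]
  split_ifs with h1 h2
  · rfl
  -- At `n = p - 1` the factor `n + 1 = p` vanishes, in agreement with the truncated coefficient
  -- being zero.
  · have : ((n + 1 : ℕ) : k) = 0 := by
      rw [show n + 1 = p by omega, CharP.cast_eq_zero]
    push_cast at this
    simp [this]
  · omega
  · simp

theorem natCast_ne_zero_of_lt {n : ℕ} (h0 : n ≠ 0) (hn : n < p) : (n : k) ≠ 0 := by
  rw [Ne, CharP.cast_eq_zero_iff k p]
  exact fun h => absurd (Nat.le_of_dvd (Nat.pos_of_ne_zero h0) h) (by omega)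

/-- Termwise integration divides only by integers prime to `p`, except in degree `p - 1`. Hence the
`X^(p-1)` coefficient is the only obstruction. -/
theorem exists_wittD_eq {b : TruncPoly k p} (hb : truncCoeff k p (p - 1) b = 0) :
    ∃ u, wittD k p u = b := by
  refine ⟨truncOfCoeff k p fun n => truncCoeff k p (n - 1) b / n, truncPoly_ext fun n hn => ?_⟩
  rw [truncCoeff_wittD, truncCoeff_truncOfCoeff]
  split_ifs with h
  · have : ((n + 1 : ℕ) : k) ≠ 0 := natCast_ne_zero_of_lt (by omega) h
    push_cast at this ⊢
    exact mul_div_cancel₀ _ this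
  · rw [mul_zero, ← hb, show n = p - 1 by omega]

theorem truncCoeff_wittD_last (a : TruncPoly k p) :
    truncCoeff k p (p - 1) (wittD k p a) = 0 := by
  rw [truncCoeff_wittD, truncCoeff_of_le (n := p - 1 + 1) (by omega), mul_zero]

end TruncatedPolynomials

/-! ### Witt algebra elements as `f D`, and their centralizers. -/

section WittAlgebra

variable {k : Type*} [Field k] {p : ℕ} [CharP k p]

theorem derivation_eq_smul_wittD (x : WittAlg k p) : x = x (truncX k p) • wittD k p := by
  refine Derivation.ext_of_adjoin_eq_top {truncX k p} adjoin_truncX ?_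
  rintro _ rfl
  simp [wittD_truncX]

variable (k p) in
/-- A derivation of the truncated polynomial algebra is determined by its value at `X`. -/
def wittEquiv : TruncPoly k p ≃ₗ[k] WittAlg k p where
  toFun f := f • wittD k p
  map_add' f g := add_smul f g _
  map_smul' c f := smul_assoc c f _
  invFun x := x (truncX k p)
  left_inv f := by simp [wittD_truncX]
  right_inv x := (derivation_eq_smul_wittD x).symm

theorem wittEquiv_apply (f a : TruncPoly k p) : wittEquiv k p f a = f * wittD k p a := rfl

instance : FiniteDimensional k (WittAlg k p) := (wittEquiv k p).finiteDimensional

theorem lie_wittEquiv_eq_zero_iff (f g : TruncPoly k p) :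
    ⁅wittEquiv k p f, wittEquiv k p g⁆ = 0 ↔ f * wittD k p g = g * wittD k p f := by
  rw [← (wittEquiv k p).symm.map_eq_zero_iff]
  change ⁅wittEquiv k p f, wittEquiv k p g⁆ (truncX k p) = 0 ↔ _
  rw [Derivation.commutator_apply, sub_eq_zero]
  simp [wittEquiv_apply, wittD_truncX]

theorem wittEquiv_mem_wittFil_iff (i : ℤ) (f : TruncPoly k p) :
    wittEquiv k p f ∈ wittFil k p i ↔ ∀ j : ℕ, (j : ℤ) ≤ i → truncCoeff k p j f = 0 := by
  constructor
  · intro h j hj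
    have hle : wittFil k p i ≤ LinearMap.ker (truncCoeff k p j ∘ₗ (wittEquiv k p).symm.toLinearMap) := by
      refine Submodule.span_le.2 ?_
      rintro _ ⟨m, hm, -, rfl⟩
      change truncCoeff k p j ((wittEquiv k p).symm (wittEquiv k p (truncX k p ^ m))) = 0
      rw [LinearEquiv.symm_apply_apply, truncCoeff_truncX_pow, if_neg (by omega)]
    simpa using hle h
  · intro h
    have hf : f = ∑ m ∈ Finset.range p, truncCoeff k p m f • truncX k p ^ m := by
      refine truncPoly_ext fun n hn => ?_
      simp [map_sum, truncCoeff_truncX_pow, hn]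
    rw [hf, map_sum]
    refine Submodule.sum_mem _ fun m hm => ?_
    rw [Finset.mem_range] at hm
    rw [map_smul]
    by_cases hmi : (m : ℤ) ≤ i
    · simp [h m hmi]
    · exact Submodule.smul_mem _ _ (Submodule.subset_span ⟨m, by omega, by omega, rfl⟩)

theorem wittEquiv_mem_wittFil_natCast_iff (i : ℕ) (f : TruncPoly k p) :
    wittEquiv k p f ∈ wittFil k p i ↔ ∀ j ≤ i, truncCoeff k p j f = 0 := by
  rw [wittEquiv_mem_wittFil_iff]
  exact forall_congr' fun j => by rw [Nat.cast_le]

/-- The centralizer of an element of order `o`, up to multiples of that element. -/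
theorem truncCoeff_eq_zero_of_commute {o : ℕ} {f g : TruncPoly k p}
    (hf : ∀ j < o, truncCoeff k p j f = 0) (hfo : truncCoeff k p o f ≠ 0)
    (hfg : f * wittD k p g = g * wittD k p f) (hgo : truncCoeff k p o g = 0) (j : ℕ)
    (hj : j + o ≤ p) : truncCoeff k p j g = 0 := by
  have ho : o < p := by
    by_contra h
    exact hfo (truncCoeff_of_le (by omega) f)
  induction j using Nat.strong_induction_on with
  | _ j ih =>
    by_cases hjo : j = o
    · rwa [hjo]
    by_cases hjp : p ≤ j
    · exact truncCoeff_of_le hjp g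
    -- The coefficient of `X^(j+o-1)` in `f g' = g f'` reads `j f_o g_j = o f_o g_j`, once the lower
    -- coefficients of `g` are known to vanish. The bound `j + o ≤ p` keeps this degree below the
    -- truncation.
    have hn : j + o - 1 < p := by omega
    have h := congrArg (truncCoeff k p (j + o - 1)) hfg
    rw [truncCoeff_mul hn, truncCoeff_mul hn] at h
    have hl : ∑ m ∈ Finset.HasAntidiagonal.antidiagonal (j + o - 1),
        truncCoeff k p m.1 f * truncCoeff k p m.2 (wittD k p g) =
        truncCoeff k p o f * (j * truncCoeff k p j g) := by
      by_cases hj0 : j = 0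
      · subst hj0
        rw [Nat.cast_zero, zero_mul, mul_zero]
        refine Finset.sum_eq_zero fun m hm => ?_
        rw [Finset.HasAntidiagonal.mem_antidiagonal] at hm
        rw [hf m.1 (by omega), zero_mul]
      · rw [Finset.sum_eq_single (o, j - 1)]
        · rw [truncCoeff_wittD, Nat.sub_add_cancel (by omega)]
          congr 2
          exact_mod_cast congrArg (Nat.cast (R := k)) (show j - 1 + 1 = j by omega)
        · rintro ⟨a, b⟩ hm hne
          rw [Finset.HasAntidiagonal.mem_antidiagonal] at hm
          dsimp only at hm ⊢
          by_cases ha : a < o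
          · rw [hf a ha, zero_mul]
          · have : a ≠ o := fun h => hne (by rw [h]; congr 1; omega)
            rw [truncCoeff_wittD, ih (b + 1) (by omega) (by omega), mul_zero, mul_zero]
        · intro hm
          rw [Finset.HasAntidiagonal.mem_antidiagonal] at hm
          omega
    have hr : ∑ m ∈ Finset.HasAntidiagonal.antidiagonal (j + o - 1),
        truncCoeff k p m.1 g * truncCoeff k p m.2 (wittD k p f) =
        truncCoeff k p j g * (o * truncCoeff k p o f) := by
      by_cases ho0 : o = 0
      · subst ho0
        rw [Nat.cast_zero, zero_mul, mul_zero]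
        refine Finset.sum_eq_zero fun m hm => ?_
        rw [Finset.HasAntidiagonal.mem_antidiagonal] at hm
        rw [ih m.1 (by omega) (by omega), zero_mul]
      · rw [Finset.sum_eq_single (j, o - 1)]
        · rw [truncCoeff_wittD, Nat.sub_add_cancel (by omega)]
          congr 2
          exact_mod_cast congrArg (Nat.cast (R := k)) (show o - 1 + 1 = o by omega)
        · rintro ⟨a, b⟩ hm hne
          rw [Finset.HasAntidiagonal.mem_antidiagonal] at hm
          dsimp only at hm ⊢
          by_cases ha : a < j
          · rw [ih a ha (by omega), zero_mul]
          · have : a ≠ j := fun h => hne (by rw [h]; congr 1; omega)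
            rw [truncCoeff_wittD, hf (b + 1) (by omega), mul_zero, mul_zero]
        · intro hm
          rw [Finset.HasAntidiagonal.mem_antidiagonal] at hm
          omega
    rw [hl, hr] at h
    -- Both indices are below `p` and distinct, hence distinct modulo `p`.
    have hne : ((j : k) - o) ≠ 0 := by
      rw [Ne, sub_eq_zero]
      intro h
      rw [CharP.natCast_eq_natCast k p] at h
      exact hjo (Nat.ModEq.eq_of_lt_of_lt h (by omega) (by omega))
    have h2 : ((j : k) - o) * truncCoeff k p o f * truncCoeff k p j g = 0 := by
      linear_combination h
    exact (mul_eq_zero.1 h2).resolve_left (mul_ne_zero hne hfo)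

end WittAlgebra

/-! ### The equation of the nilpotent variety, and its parametrization by `(p-1)`-th powers. -/

section NilpotentVariety

section Iterates

variable {k : Type*} [Field k] {p : ℕ} [CharP k p]

theorem truncCoeff_wittEquiv_apply_of_unit {f : TruncPoly k p} (hf : truncCoeff k p 0 f ≠ 0) {m : ℕ}
    (hm : m + 1 < p) {a : TruncPoly k p}
    (ha : ∀ j < m + 1, truncCoeff k p j a = 0) (ham : truncCoeff k p (m + 1) a ≠ 0) :
    (∀ j < m, truncCoeff k p j (wittEquiv k p f a) = 0) ∧
      truncCoeff k p m (wittEquiv k p f a) ≠ 0 := by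
  constructor
  · intro j hj
    rw [wittEquiv_apply, truncCoeff_mul (by omega)]
    refine Finset.sum_eq_zero fun i hi => ?_
    rw [Finset.HasAntidiagonal.mem_antidiagonal] at hi
    rw [truncCoeff_wittD, ha _ (by omega), mul_zero, mul_zero]
  · rw [wittEquiv_apply, truncCoeff_mul (by omega), Finset.sum_eq_single (0, m)]
    · rw [truncCoeff_wittD]
      have h : ((m + 1 : ℕ) : k) ≠ 0 := natCast_ne_zero_of_lt (p := p) (by omega) hm
      push_cast at h
      exact mul_ne_zero hf (mul_ne_zero h ham)
    · rintro ⟨i, j⟩ hi hne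
      rw [Finset.HasAntidiagonal.mem_antidiagonal] at hi
      dsimp only at hi ⊢
      have : j ≠ m := fun h => hne (by rw [h]; congr 1; omega)
      rw [truncCoeff_wittD, ha _ (by omega), mul_zero, mul_zero]
    · intro h
      rw [Finset.HasAntidiagonal.mem_antidiagonal] at h
      omega

/-- For a unit `f`, each application of `f D` lowers a positive order below `p` by exactly one, so
`m` applications bring order `m` down to zero. -/
theorem iterate_wittEquiv_ne_zero {f : TruncPoly k p} (hf : truncCoeff k p 0 f ≠ 0) {m : ℕ}
    (hm : m < p) : truncCoeff k p 0 ((wittEquiv k p f)^[m] (truncX k p ^ m)) ≠ 0 := by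
  suffices ∀ a : TruncPoly k p, (∀ j < m, truncCoeff k p j a = 0) → truncCoeff k p m a ≠ 0 →
      truncCoeff k p 0 ((wittEquiv k p f)^[m] a) ≠ 0 by
    refine this _ (fun j hj => ?_) ?_
    · rw [truncCoeff_truncX_pow, if_neg (by omega)]
    · rw [truncCoeff_truncX_pow, if_pos ⟨hm, rfl⟩]
      exact one_ne_zero
  induction m with
  | zero => exact fun a _ ha => ha
  | succ m ih =>
    intro a ha ham
    obtain ⟨h1, h2⟩ := truncCoeff_wittEquiv_apply_of_unit hf hm ha ham
    exact ih (by omega) _ h1 h2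

end Iterates

variable {k : Type*} [Field k] {p : ℕ} [Fact p.Prime] [CharP k p]

theorem derivationPMap_apply (x : WittAlg k p) (a : TruncPoly k p) :
    derivationPMap p x a = x^[p] a := by
  change ((x : Module.End k (TruncPoly k p)) ^ p) a = _
  rw [Module.End.pow_apply]
  rfl

theorem wittEquiv_mem_nilVar_iff_iterate (f : TruncPoly k p) :
    wittEquiv k p f ∈ nilVar k p ↔ ∀ a, (wittEquiv k p f)^[p] a = 0 := by
  constructor
  · intro h a
    rw [← derivationPMap_apply, show derivationPMap p (wittEquiv k p f) = 0 from h,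
      Derivation.zero_apply]
  · intro h
    refine Derivation.ext fun a => ?_
    rw [derivationPMap_apply, h, Derivation.zero_apply]

theorem mul_pow_pred_char (f : TruncPoly k p) :
    f * f ^ (p - 1) = algebraMap k _ (truncCoeff k p 0 f ^ p) := by
  rw [mul_pow_sub_one (Fact.out : p.Prime).ne_zero, truncPoly_pow_char]

/-- Here `f^(p-1)` is a nonzero scalar times the inverse of `f`, so the coefficient condition says
that this inverse has an antiderivative. Such an antiderivative is a function that `f D` sends to a
nonzero constant. -/
theorem wittEquiv_mem_nilVar_iff_of_unit {f : TruncPoly k p} (hf : truncCoeff k p 0 f ≠ 0) :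
    wittEquiv k p f ∈ nilVar k p ↔ truncCoeff k p (p - 1) (f ^ (p - 1)) = 0 := by
  have hp : p.Prime := Fact.out
  have hp2 := hp.two_le
  have hc : truncCoeff k p 0 f ^ p ≠ 0 := pow_ne_zero _ hf
  constructor
  · intro h
    rw [wittEquiv_mem_nilVar_iff_iterate] at h
    -- This `w` has nonzero constant term and is killed by `f D`, hence is a nonzero constant. As `w
    -- = f D v`, the product `f^(p-1) w` is a scalar multiple of the derivative `D v`, which has no
    -- `X^(p-1)` term.
    set w := (wittEquiv k p f)^[p - 1] (truncX k p ^ (p - 1)) with hw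
    have hw0 : truncCoeff k p 0 w ≠ 0 := iterate_wittEquiv_ne_zero hf (by omega)
    have hwk : f * wittD k p w = 0 := by
      rw [← wittEquiv_apply, hw, ← Function.iterate_succ_apply' (wittEquiv k p f), Nat.succ_eq_add_one,
        Nat.sub_add_cancel (by omega), h]
    have hDw : wittD k p w = 0 := by
      have h1 := congrArg (f ^ (p - 1) * ·) hwk
      simp only [mul_zero, ← mul_assoc] at h1
      rw [mul_comm (f ^ (p - 1)), mul_pow_pred_char, ← Algebra.smul_def] at h1
      exact (smul_eq_zero.1 h1).resolve_left hc
    have hwc : w = algebraMap k _ (truncCoeff k p 0 w) := by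
      refine truncPoly_ext fun n hn => ?_
      rw [truncCoeff_algebraMap]
      split_ifs with h0
      · rw [h0]
      · have h1 := congrArg (truncCoeff k p (n - 1)) hDw
        rw [truncCoeff_wittD, map_zero, Nat.sub_add_cancel (by omega), Nat.cast_sub (by omega),
          Nat.cast_one, sub_add_cancel] at h1
        exact (mul_eq_zero.1 h1).resolve_left (natCast_ne_zero_of_lt (p := p) h0 hn)
    set v := (wittEquiv k p f)^[p - 2] (truncX k p ^ (p - 1)) with hv
    have hwv : w = f * wittD k p v := by
      rw [← wittEquiv_apply, hv, ← Function.iterate_succ_apply' (wittEquiv k p f), hw,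
        show (p - 2).succ = p - 1 by omega]
    have h2 : truncCoeff k p (p - 1) (f ^ (p - 1) * w) = 0 := by
      rw [hwv, ← mul_assoc, mul_comm (f ^ (p - 1)), mul_pow_pred_char, ← Algebra.smul_def, map_smul,
        truncCoeff_wittD_last, smul_zero]
    rw [hwc, mul_comm, ← Algebra.smul_def, map_smul, smul_eq_mul] at h2
    exact (mul_eq_zero.1 h2).resolve_left hw0
  · intro h
    obtain ⟨u, hu⟩ := exists_wittD_eq h
    have hEu : wittEquiv k p f u = algebraMap k _ (truncCoeff k p 0 f ^ p) := by
      rw [wittEquiv_apply, hu, mul_pow_pred_char]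
    -- The `p`-th power is again a derivation `g D`. It kills `u`, because `f D u` is already
    -- constant, so `g f^(p-1) = 0`. Since `f` is a unit, `g = 0`.
    obtain ⟨g, hg⟩ := (wittEquiv k p).surjective (derivationPMap p (wittEquiv k p f))
    have h1 : derivationPMap p (wittEquiv k p f) u = 0 := by
      rw [derivationPMap_apply]
      obtain ⟨q, hq⟩ : ∃ q, p = q + 2 := ⟨p - 2, by omega⟩
      have h2 : (wittEquiv k p f)^[2] u = 0 := by
        rw [Function.iterate_succ_apply', Function.iterate_one, hEu, Derivation.map_algebraMap]
      have h3 : (wittEquiv k p f)^[q + 2] u = 0 := by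
        rw [Function.iterate_add_apply, h2]
        exact Function.iterate_fixed (map_zero _) _
      rwa [← hq] at h3
    rw [← hg, wittEquiv_apply, hu] at h1
    have h2 := congrArg (· * f) h1
    simp only [zero_mul, mul_assoc] at h2
    rw [mul_comm _ f, mul_pow_pred_char, mul_comm, ← Algebra.smul_def] at h2
    have h3 := (smul_eq_zero.1 h2).resolve_left hc
    change derivationPMap p (wittEquiv k p f) = 0
    rw [← hg, h3, map_zero]

/-- When `f(0) = 0`, the operator `f D` preserves the order filtration and acts on the linear
coefficient by multiplication by `f_1`. If `f_1 = 0` as well, it raises the filtration by one at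
each step. -/
theorem wittEquiv_mem_nilVar_iff_of_nonunit {f : TruncPoly k p} (hf : truncCoeff k p 0 f = 0) :
    wittEquiv k p f ∈ nilVar k p ↔ truncCoeff k p 1 f = 0 := by
  have hp : p.Prime := Fact.out
  have hp2 := hp.two_le
  rw [wittEquiv_mem_nilVar_iff_iterate]
  constructor
  · intro h
    have h1 (n : ℕ) (a : TruncPoly k p) : truncCoeff k p 1 ((wittEquiv k p f)^[n] a) =
        truncCoeff k p 1 f ^ n * truncCoeff k p 1 a := by
      induction n with
      | zero => simp
      | succ n ih =>
        rw [Function.iterate_succ_apply', wittEquiv_apply, truncCoeff_mul (by omega),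
          Finset.Nat.sum_antidiagonal_eq_sum_range_succ_mk]
        simp only [Finset.sum_range_succ, Finset.sum_range_zero, hf, truncCoeff_wittD, Nat.sub_self,
          ih]
        push_cast
        ring
    have h2 := h1 p (truncX k p ^ 1)
    rw [h, map_zero, truncCoeff_truncX_pow, if_pos ⟨by omega, rfl⟩, mul_one] at h2
    exact pow_eq_zero_iff hp.ne_zero |>.1 h2.symm
  · intro hf1 a
    have h1 (n : ℕ) : ∀ j < n, truncCoeff k p j ((wittEquiv k p f)^[n] a) = 0 := by
      induction n with
      | zero => simp
      | succ n ih =>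
        intro j hj
        by_cases hjp : p ≤ j
        · exact truncCoeff_of_le hjp _
        rw [Function.iterate_succ_apply', wittEquiv_apply, truncCoeff_mul (by omega)]
        refine Finset.sum_eq_zero fun m hm => ?_
        rw [Finset.HasAntidiagonal.mem_antidiagonal] at hm
        by_cases hm2 : 2 ≤ m.1
        · rw [truncCoeff_wittD, ih _ (by omega), mul_zero, mul_zero]
        · have : m.1 = 0 ∨ m.1 = 1 := by omega
          rcases this with h | h <;> simp [h, hf, hf1]
    exact truncPoly_ext fun n hn => by rw [h1 p n hn, map_zero]

/-- The nilpotent variety is the hypersurface `[X^(p-1)] f^(p-1) = 0`. -/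
theorem wittEquiv_mem_nilVar_iff (f : TruncPoly k p) :
    wittEquiv k p f ∈ nilVar k p ↔ truncCoeff k p (p - 1) (f ^ (p - 1)) = 0 := by
  have hp : p.Prime := Fact.out
  have hp2 := hp.two_le
  by_cases hf : truncCoeff k p 0 f = 0
  · rw [wittEquiv_mem_nilVar_iff_of_nonunit hf]
    obtain ⟨b, hb⟩ := exists_eq_truncX_pow_mul (m := 1) (a := f) hp.one_lt.le fun j hj => by
      rwa [show j = 0 by omega]
    rw [hb, mul_pow, ← pow_mul, one_mul, truncCoeff_truncX_pow_mul (by omega),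
      truncCoeff_truncX_pow_mul (by omega), if_pos le_rfl, if_pos le_rfl, Nat.sub_self, Nat.sub_self,
      truncCoeff_zero_pow, pow_eq_zero_iff (by omega)]
  · exact wittEquiv_mem_nilVar_iff_of_unit hf

/-- The exponent is `(p-1)^2 = p(p-2) + 1`, and `p`-th powers are scalars. Up to scalars, the power
map is thus its own inverse on units. -/
theorem pow_pred_pow_pred (f : TruncPoly k p) :
    (f ^ (p - 1)) ^ (p - 1) = (truncCoeff k p 0 f ^ p) ^ (p - 2) • f := by
  have hp2 := (Fact.out : p.Prime).two_le
  obtain ⟨q, rfl⟩ : ∃ q, p = q + 2 := ⟨p - 2, by omega⟩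
  rw [← pow_mul, show (q + 2 - 1) * (q + 2 - 1) = (q + 2) * q + 1 by simp; ring, pow_succ, pow_mul,
    truncPoly_pow_char, ← map_pow, ← Algebra.smul_def, Nat.add_sub_cancel]

theorem wittEquiv_pow_pred_mem_nilVar {h : TruncPoly k p} (hh : truncCoeff k p (p - 1) h = 0) :
    wittEquiv k p (h ^ (p - 1)) ∈ nilVar k p := by
  rw [wittEquiv_mem_nilVar_iff, pow_pred_pow_pred, map_smul, hh, smul_zero]

theorem exists_pow_pred_eq_of_mem_nilVar [IsAlgClosed k] {f : TruncPoly k p}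
    (hf0 : truncCoeff k p 0 f ≠ 0) (hf : wittEquiv k p f ∈ nilVar k p) :
    ∃ h : TruncPoly k p, truncCoeff k p (p - 1) h = 0 ∧ h ^ (p - 1) = f := by
  have hp2 := (Fact.out : p.Prime).two_le
  set c := (truncCoeff k p 0 f ^ p) ^ (p - 2)
  have hc : c ≠ 0 := pow_ne_zero _ (pow_ne_zero _ hf0)
  -- The scalar `l` corrects the factor `c` in the `(p-1)`-th power of `f^(p-1)`.
  obtain ⟨l, hl⟩ := IsAlgClosed.exists_pow_nat_eq c⁻¹ (show 0 < p - 1 by omega)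
  refine ⟨l • f ^ (p - 1), ?_, ?_⟩
  · rw [map_smul, (wittEquiv_mem_nilVar_iff f).1 hf, smul_zero]
  · rw [_root_.smul_pow, pow_pred_pow_pred, hl, smul_smul, inv_mul_cancel₀ hc, one_smul]

end NilpotentVariety

/-! ### Density of the open part of a hypersurface that is linear in one coordinate. -/

section HypersurfaceDensity

variable {k : Type*} [Field k] {V : Type*} [AddCommGroup V] [Module k V]

/-- Division with remainder by `P - l^m Y`: after multiplication by a power of `l`, each occurrence
of `Y` can be replaced through `l^m Y ≡ P`, leaving a remainder constant in the direction `e`. -/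
theorem exists_pow_mul_eq_add {l Y : Module.Dual k V} {e : V} {P : V → k}
    (hP : P ∈ polyFun k V) (hPe : ∀ v (s : k), P (v + s • e) = P v) (hle : l e = 0) (hYe : Y e = 1)
    (m : ℕ) {h : V → k} (hh : h ∈ polyFun k V) :
    ∃ M : ℕ, ∃ q ∈ polyFun k V, ∃ r ∈ polyFun k V, (∀ v (s : k), r (v + s • e) = r v) ∧
      ∀ v, l v ^ M * h v = (P v - l v ^ m * Y v) * q v + r v := by
  have hlm (M : ℕ) : (fun v => l v ^ M) ∈ polyFun k V := pow_mem (dual_mem_polyFun l) M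
  have hF : (fun v => P v - l v ^ m * Y v) ∈ polyFun k V :=
    sub_mem hP (mul_mem (hlm m) (dual_mem_polyFun Y))
  induction hh using Algebra.adjoin_induction with
  | mem h hh =>
    obtain ⟨φ, rfl⟩ := hh
    refine ⟨m, fun _ => -φ e, const_mem_polyFun _,
      fun v => l v ^ m * (φ - φ e • Y) v + φ e * P v,
      add_mem (mul_mem (hlm m) (dual_mem_polyFun _)) (mul_mem (const_mem_polyFun _) hP), ?_, ?_⟩
    · intro v s
      simp only [hPe, map_add, map_smul, hle, LinearMap.sub_apply, LinearMap.smul_apply, hYe,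
        smul_eq_mul]
      ring
    · intro v
      simp only [LinearMap.sub_apply, LinearMap.smul_apply, smul_eq_mul]
      ring
  | algebraMap c =>
    exact ⟨0, 0, zero_mem _, fun _ => c, const_mem_polyFun c, fun _ _ => rfl, fun v => by simp⟩
  | add f g _ _ hf hg =>
    obtain ⟨M, q, hq, r, hr, hre, h⟩ := hf
    obtain ⟨M', q', hq', r', hr', hre', h'⟩ := hg
    refine ⟨M + M', fun v => l v ^ M' * q v + l v ^ M * q' v,
      add_mem (mul_mem (hlm M') hq) (mul_mem (hlm M) hq'),
      fun v => l v ^ M' * r v + l v ^ M * r' v,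
      add_mem (mul_mem (hlm M') hr) (mul_mem (hlm M) hr'), ?_, ?_⟩
    · intro v s
      simp only [hre, hre', map_add, map_smul, hle, smul_zero, add_zero]
    · intro v
      rw [Pi.add_apply]
      linear_combination l v ^ M' * h v + l v ^ M * h' v
  | mul f g _ _ hf hg =>
    obtain ⟨M, q, hq, r, hr, hre, h⟩ := hf
    obtain ⟨M', q', hq', r', hr', hre', h'⟩ := hg
    refine ⟨M + M', fun v => q v * ((P v - l v ^ m * Y v) * q' v + r' v) + r v * q' v,
      add_mem (mul_mem hq (add_mem (mul_mem hF hq') hr')) (mul_mem hr hq'), fun v => r v * r' v,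
      mul_mem hr hr', ?_, ?_⟩
    · intro v s
      simp only [hre, hre']
    · intro v
      rw [Pi.mul_apply]
      linear_combination l v ^ M' * g v * h v + ((P v - l v ^ m * Y v) * q v + r v) * h' v

/-- The linear form `l` is a prime element not dividing `F`, so powers of `l` cancel. On `l = 0` the
product `F q` vanishes while `F` does not vanish identically, so `q` vanishes there and is a
multiple of `l`. -/
theorem exists_eq_mul_of_pow_mul_eq_mul [Infinite k] {l : Module.Dual k V} {e : V} (he : l e = 1)
    {F : V → k} (hF : F ∈ polyFun k V) (hFl : ∃ v, l v = 0 ∧ F v ≠ 0) (M : ℕ) {h q : V → k}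
    (hh : h ∈ polyFun k V) (hq : q ∈ polyFun k V) (hhq : ∀ v, l v ^ M * h v = F v * q v) :
    ∃ q' ∈ polyFun k V, ∀ v, h v = F v * q' v := by
  induction M generalizing q with
  | zero => exact ⟨q, hq, fun v => by simpa using hhq v⟩
  | succ M ih =>
    have hπ : IsPolyMap k (fun v : V => v - l v • e) :=
      LinearMap.isPolyMap (LinearMap.id - l.smulRight e)
    have hlπ (v : V) : l (v - l v • e) = 0 := by simp [he]
    have hq0 : ∀ v, q (v - l v • e) = 0 := by
      refine (polyFun_eq_zero_or_eq_zero (hπ.comp_mem hF) (hπ.comp_mem hq) fun v => ?_).resolve_left ?_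
      · rw [← hhq, hlπ, pow_succ, mul_zero, zero_mul]
      · obtain ⟨v, hv, hFv⟩ := hFl
        intro h0
        have := h0 v
        simp only [hv, zero_smul, sub_zero] at this
        exact hFv this
    obtain ⟨q₁, hq₁, h₁⟩ := exists_eq_add_mul_of_dual l e hq
    refine ih hq₁ fun v => ?_
    have hdiff : (fun v => l v ^ M * h v - F v * q₁ v) ∈ polyFun k V :=
      sub_mem (mul_mem (pow_mem (dual_mem_polyFun l) M) hh) (mul_mem hF hq₁)
    have := (polyFun_eq_zero_or_eq_zero (dual_mem_polyFun l) hdiff fun v => by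
      have h2 := hhq v
      have h3 := h₁ v
      rw [hq0, zero_add] at h3
      rw [h3] at h2
      linear_combination h2).resolve_left fun h0 => by
        rw [h0 e] at he
        exact zero_ne_one he
    exact sub_eq_zero.1 (this v)

/-- A hypersurface `P = l^m Y`, with `P` independent of `Y`, is the closure of its part outside the
hyperplane `l = 0`, provided that it does not contain that hyperplane. -/
theorem eq_zero_on_hypersurface [Infinite k] {l Y : Module.Dual k V} {e e₀ : V} {P : V → k}
    (hP : P ∈ polyFun k V) (hPe : ∀ v (s : k), P (v + s • e) = P v) (hle : l e = 0) (hYe : Y e = 1)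
    (he₀ : l e₀ = 1) {m : ℕ} (hFl : ∃ v, l v = 0 ∧ P v - l v ^ m * Y v ≠ 0) {h : V → k}
    (hh : h ∈ polyFun k V) (hv : ∀ v, l v ≠ 0 → P v - l v ^ m * Y v = 0 → h v = 0) {v : V}
    (hFv : P v - l v ^ m * Y v = 0) : h v = 0 := by
  obtain ⟨M, q, hq, r, hr, hre, hM⟩ := exists_pow_mul_eq_add hP hPe hle hYe m hh
  have hr0 : ∀ v, r v = 0 := by
    refine (polyFun_eq_zero_or_eq_zero (dual_mem_polyFun l) hr fun w => ?_).resolve_left fun h0 => by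
      rw [h0 e₀] at he₀
      exact zero_ne_one he₀
    by_cases hw : l w = 0
    · rw [hw, zero_mul]
    -- This `s` moves `w` along `e` onto the hypersurface without changing `l` or `r`.
    · set s := (P w - l w ^ m * Y w) / l w ^ m with hs
      have hlw : l (w + s • e) = l w := by simp [hle]
      have hF : P (w + s • e) - l (w + s • e) ^ m * Y (w + s • e) = 0 := by
        rw [hPe, hlw, map_add, map_smul, hYe, hs, smul_eq_mul, mul_one]
        have : l w ^ m ≠ 0 := pow_ne_zero _ hw
        field_simp
        ring
      have h1 := hM (w + s • e)
      rw [hF, zero_mul, zero_add, hre, hv _ (by rwa [hlw]) hF, mul_zero] at h1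
      rw [← h1, mul_zero]
  have hF : (fun v => P v - l v ^ m * Y v) ∈ polyFun k V :=
    sub_mem hP (mul_mem (pow_mem (dual_mem_polyFun l) m) (dual_mem_polyFun Y))
  obtain ⟨q', -, hq'⟩ := exists_eq_mul_of_pow_mul_eq_mul he₀ hF hFl M hh hq fun w => by
    rw [hM, hr0, add_zero]
  rw [hq', hFv, zero_mul]

end HypersurfaceDensity

/-! ### Products and powers of algebra-valued polynomial maps. -/

section PolynomialMaps

variable {k : Type*} [Field k] {V : Type*} [AddCommGroup V] [Module k V]
variable {A : Type*} [CommRing A] [Algebra k A] [FiniteDimensional k A]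

theorem isPolyMap_sum {U : Type*} [AddCommGroup U] [Module k U] {ι : Type*} (s : Finset ι)
    {φ : ι → V → U} (h : ∀ i ∈ s, IsPolyMap k (φ i)) : IsPolyMap k (fun v => ∑ i ∈ s, φ i v) := by
  intro l
  have := sum_mem (S := polyFun k V) (t := s) (f := fun i v => l (φ i v)) fun i hi => h i hi l
  convert this using 1
  ext v
  simp

theorem IsPolyMap.mul {φ ψ : V → A} (hφ : IsPolyMap k φ) (hψ : IsPolyMap k ψ) :
    IsPolyMap k (fun v => φ v * ψ v) := by
  let b := Module.finBasis k A
  have h : (fun v => φ v * ψ v) = fun v => ∑ i, b.coord i (φ v) • (b i * ψ v) := by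
    ext v
    conv_lhs => rw [← b.sum_repr (φ v), Finset.sum_mul]
    simp
  rw [h]
  exact isPolyMap_sum _ fun i _ => IsPolyMap.smul (hφ _) fun l =>
    hψ (l ∘ₗ LinearMap.mulLeft k (b i))

theorem IsPolyMap.pow {φ : V → A} (hφ : IsPolyMap k φ) (n : ℕ) : IsPolyMap k (fun v => φ v ^ n) := by
  induction n with
  | zero =>
    intro l
    simpa only [pow_zero] using const_mem_polyFun (l 1)
  | succ n ih => simpa only [pow_succ] using ih.mul hφ

end PolynomialMaps

/-! ### Density in `𝒩` of the elements with nonzero constant term. -/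

section NilpotentDensity

variable {k : Type*} [Field k] {p : ℕ} [Fact p.Prime] [CharP k p]

theorem add_pow_of_mul_self_eq_zero {A : Type*} [CommRing A] {z : A} (hz : z * z = 0) (a : A)
    (n : ℕ) : (a + z) ^ (n + 1) = a ^ (n + 1) + (n + 1) * (a ^ n * z) := by
  induction n with
  | zero => simp
  | succ n ih =>
    rw [pow_succ, ih]
    push_cast
    linear_combination (n + 1 : A) * a ^ n * hz

/-- The top term `z` of `f` has square zero, so `f^(p-1)` is linear in `z` with factor `p - 1 = -1`.
The nilpotency equation thereby takes the shape required by `eq_zero_on_hypersurface`. -/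
theorem truncCoeff_pow_pred_eq (hp : 2 < p) (f : TruncPoly k p) :
    truncCoeff k p (p - 1) (f ^ (p - 1)) =
      truncCoeff k p (p - 1) ((f - truncCoeff k p (p - 1) f • truncX k p ^ (p - 1)) ^ (p - 1)) -
        truncCoeff k p 0 f ^ (p - 2) * truncCoeff k p (p - 1) f := by
  set y := truncCoeff k p (p - 1) f
  set z := y • truncX k p ^ (p - 1) with hz
  have hzz : z * z = 0 := by
    rw [hz, smul_mul_smul_comm, ← pow_add, truncX_pow_eq_zero (by omega), smul_zero]
  have h0 : truncCoeff k p 0 (f - z) = truncCoeff k p 0 f := by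
    rw [map_sub, hz, map_smul, truncCoeff_truncX_pow, if_neg (by omega), smul_zero, sub_zero]
  have hpk : ((p - 2 : ℕ) : k) + 1 = -1 := by
    have h1 : ((p - 2 + 2 : ℕ) : k) = 0 := by rw [Nat.sub_add_cancel hp.le, CharP.cast_eq_zero]
    push_cast at h1
    linear_combination h1
  have h := add_pow_of_mul_self_eq_zero hzz (f - z) (p - 2)
  rw [sub_add_cancel, show p - 2 + 1 = p - 1 by omega] at h
  have hcast : (((p - 2 : ℕ) : TruncPoly k p) + 1) = algebraMap k _ (-1) := by
    rw [← hpk]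
    simp
  rw [h, hcast, ← Algebra.smul_def, map_add, map_smul, hz, mul_smul_comm, map_smul, mul_comm _ (truncX k p ^ (p - 1)),
    truncCoeff_truncX_pow_mul (by omega), if_pos le_rfl, Nat.sub_self, truncCoeff_zero_pow, ← hz, h0,
    smul_eq_mul, smul_eq_mul]
  ring

/-- The nilpotent variety is the closure of its part outside `𝔤_0`. -/
theorem eq_zero_on_nilVar [Infinite k] (hp : 2 < p) {h : TruncPoly k p → k}
    (hh : h ∈ polyFun k (TruncPoly k p))
    (hv : ∀ f, truncCoeff k p 0 f ≠ 0 → wittEquiv k p f ∈ nilVar k p → h f = 0) {f : TruncPoly k p}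
    (hf : wittEquiv k p f ∈ nilVar k p) : h f = 0 := by
  let π : TruncPoly k p →ₗ[k] TruncPoly k p :=
    LinearMap.id - (truncCoeff k p (p - 1)).smulRight (truncX k p ^ (p - 1))
  let P : TruncPoly k p → k := fun f => truncCoeff k p (p - 1) (π f ^ (p - 1))
  have hF (f : TruncPoly k p) : truncCoeff k p (p - 1) (f ^ (p - 1)) =
      P f - truncCoeff k p 0 f ^ (p - 2) * truncCoeff k p (p - 1) f := truncCoeff_pow_pred_eq hp f
  have hYe : truncCoeff k p (p - 1) (truncX k p ^ (p - 1)) = 1 := by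
    rw [truncCoeff_truncX_pow, if_pos ⟨by omega, rfl⟩]
  have hπ : π (truncX k p ^ (p - 1)) = 0 := by simp [π, hYe]
  have hP : P ∈ polyFun k (TruncPoly k p) :=
    ((LinearMap.isPolyMap π).pow (p - 1)) (truncCoeff k p (p - 1))
  refine eq_zero_on_hypersurface (l := truncCoeff k p 0) (Y := truncCoeff k p (p - 1))
    (e := truncX k p ^ (p - 1)) (e₀ := truncX k p ^ 0) (P := P) (m := p - 2) hP ?_ ?_ hYe ?_ ?_ hh ?_ ?_
  · intro v s
    simp only [P, map_add, map_smul, hπ, smul_zero, add_zero]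
  · rw [truncCoeff_truncX_pow, if_neg (by omega)]
  · rw [truncCoeff_truncX_pow, if_pos ⟨by omega, rfl⟩]
  -- The element `X D` is not nilpotent, so the hypersurface does not contain the hyperplane `f(0) =
  -- 0`.
  · refine ⟨truncX k p ^ 1, ?_, ?_⟩
    · rw [truncCoeff_truncX_pow, if_neg (by omega)]
    · rw [← hF, ← pow_mul, one_mul, hYe]
      exact one_ne_zero
  · intro f hf0 hf
    rw [← hF, ← wittEquiv_mem_nilVar_iff] at hf
    exact hv f hf0 hf
  · rwa [← hF, ← wittEquiv_mem_nilVar_iff]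

end NilpotentDensity

/-! ### Linear dependence modulo a subspace as vanishing of minors. -/

section LinearDependence

variable {k : Type*} [Field k] {V : Type*} [AddCommGroup V] [Module k V]

/-- These are the 2×2 minors of the images of `x` and `y` in `V / U`. If `φ x ≠ 0` for some `φ`
vanishing on `U`, then `φ x • y - φ y • x` is annihilated by every such form and lies in `U`. -/
theorem exists_linear_relation_iff (U : Submodule k V) (x y : V) :
    (∃ s t : k, (s ≠ 0 ∨ t ≠ 0) ∧ s • x + t • y ∈ U) ↔
      ∀ φ ∈ U.dualAnnihilator, ∀ ψ ∈ U.dualAnnihilator, φ x * ψ y - φ y * ψ x = 0 := by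
  constructor
  · rintro ⟨s, t, hst, h⟩ φ hφ ψ hψ
    have h1 := (Submodule.mem_dualAnnihilator φ).1 hφ _ h
    have h2 := (Submodule.mem_dualAnnihilator ψ).1 hψ _ h
    simp only [map_add, map_smul, smul_eq_mul] at h1 h2
    rcases hst with hs | ht
    · refine (mul_eq_zero.1 ?_).resolve_left hs
      linear_combination ψ y * h1 - φ y * h2
    · refine (mul_eq_zero.1 ?_).resolve_left ht
      linear_combination φ x * h2 - ψ x * h1
  · intro h
    by_cases hx : x ∈ U
    · exact ⟨1, 0, Or.inl one_ne_zero, by simpa using hx⟩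
    rw [← Subspace.dualAnnihilator_dualCoannihilator_eq (W := U),
      Submodule.mem_dualCoannihilator] at hx
    push Not at hx
    obtain ⟨φ, hφ, hφx⟩ := hx
    refine ⟨-φ y, φ x, Or.inr hφx, ?_⟩
    rw [← Subspace.dualAnnihilator_dualCoannihilator_eq (W := U), Submodule.mem_dualCoannihilator]
    intro ψ hψ
    simp only [map_add, map_smul, smul_eq_mul]
    linear_combination h φ hφ ψ hψ

end LinearDependence

/-! ### The closed sets `depPairs`: commutation, covering and non-inclusion. -/

section CommutingPairs

variable (k : Type*) [Field k] (p : ℕ)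

instance : AddCommGroup (WittPair k p) := inferInstanceAs (AddCommGroup (WittAlg k p × WittAlg k p))

instance : Module k (WittPair k p) := inferInstanceAs (Module k (WittAlg k p × WittAlg k p))

instance : ZariskiSpace k (WittPair k p) :=
  zariskiTopology_zariskiSpace k (WittAlg k p × WittAlg k p)

instance [CharP k p] : FiniteDimensional k (WittPair k p) :=
  inferInstanceAs (FiniteDimensional k (WittAlg k p × WittAlg k p))

variable {k p} in
/-- A pair of elements of the Witt algebra. -/
def wittPair (x y : WittAlg k p) : WittPair k p := (x, y)

/-- The linear projection from pairs to the first entry. -/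
def wittFst : WittPair k p →ₗ[k] WittAlg k p := LinearMap.fst k (WittAlg k p) (WittAlg k p)

/-- The linear projection from pairs to the second entry. -/
def wittSnd : WittPair k p →ₗ[k] WittAlg k p := LinearMap.snd k (WittAlg k p) (WittAlg k p)

variable [Fact p.Prime] [CharP k p]

/-- The pieces `𝒩, 𝔤_1, 𝔤_2, …` of the nilpotent variety. -/
def nilFil (i : ℕ) : Set (WittAlg k p) := if i = 0 then nilVar k p else wittFil k p i

/-- Pairs in the `i`-th piece of the nilpotent variety which are linearly dependent
modulo `𝔤_{p-1-i}`. -/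
def depPairs (i : ℕ) : Set (WittPair k p) :=
  {z | z.1 ∈ nilFil k p i ∧ z.2 ∈ nilFil k p i ∧
    ∃ s t : k, (s ≠ 0 ∨ t ≠ 0) ∧ s • z.1 + t • z.2 ∈ wittFil k p ((p - 1 - i : ℕ) : ℤ)}

variable {k p}

omit [Fact (Nat.Prime p)] [CharP k p] in
theorem isPolyMap_wittPair {W : Type*} [AddCommGroup W] [Module k W] {φ ψ : W → WittAlg k p}
    (hφ : IsPolyMap k φ) (hψ : IsPolyMap k ψ) :
    IsPolyMap k (V := WittPair k p) (fun w => wittPair (φ w) (ψ w)) :=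
  hφ.prodMk hψ

theorem nilFil_zero : nilFil k p 0 = nilVar k p := if_pos rfl

theorem nilFil_of_ne_zero {i : ℕ} (hi : i ≠ 0) : nilFil k p i = wittFil k p i := if_neg hi

omit [Fact (Nat.Prime p)] in
theorem wittFil_antitone {i j : ℤ} (hij : i ≤ j) : wittFil k p j ≤ wittFil k p i :=
  Submodule.span_mono fun _ ⟨m, hm, hmp, hx⟩ => ⟨m, by omega, hmp, hx⟩

omit [Fact (Nat.Prime p)] in
theorem wittFil_eq_bot {i : ℕ} (hi : p - 1 ≤ i) : wittFil k p i = ⊥ := by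
  rw [eq_bot_iff]
  intro x hx
  obtain ⟨f, rfl⟩ := (wittEquiv k p).surjective x
  rw [wittEquiv_mem_wittFil_natCast_iff] at hx
  have : f = 0 := truncPoly_ext fun n hn => by rw [hx n (by omega), map_zero]
  rw [this, map_zero]
  exact Submodule.zero_mem _

theorem wittFil_subset_nilVar {i : ℕ} (hi : i ≠ 0) : (wittFil k p i : Set (WittAlg k p)) ⊆ nilVar k p := by
  intro x hx
  obtain ⟨f, rfl⟩ := (wittEquiv k p).surjective x
  rw [SetLike.mem_coe, wittEquiv_mem_wittFil_natCast_iff] at hx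
  rw [wittEquiv_mem_nilVar_iff_of_nonunit (hx 0 (by omega))]
  exact hx 1 (by omega)

theorem nilFil_subset_nilVar (i : ℕ) : nilFil k p i ⊆ nilVar k p := by
  by_cases hi : i = 0
  · rw [hi, nilFil_zero]
  · rw [nilFil_of_ne_zero hi]
    exact wittFil_subset_nilVar hi

theorem smul_mem_nilVar (c : k) {x : WittAlg k p} (hx : x ∈ nilVar k p) : c • x ∈ nilVar k p := by
  obtain ⟨f, rfl⟩ := (wittEquiv k p).surjective x
  rw [← map_smul]
  rw [wittEquiv_mem_nilVar_iff] at hx ⊢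
  rw [_root_.smul_pow, map_smul, hx, smul_zero]

theorem zero_mem_nilFil (i : ℕ) : (0 : WittAlg k p) ∈ nilFil k p i := by
  have hp := (Fact.out : p.Prime).two_le
  by_cases hi : i = 0
  · rw [hi, nilFil_zero, ← map_zero (wittEquiv k p), wittEquiv_mem_nilVar_iff,
      zero_pow (by omega), map_zero]
  · rw [nilFil_of_ne_zero hi]
    exact Submodule.zero_mem _

omit [Fact (Nat.Prime p)] in
theorem wittEquiv_truncX_pow_mem_wittFil_iff {m i : ℕ} (hm : m < p) :
    wittEquiv k p (truncX k p ^ m) ∈ wittFil k p i ↔ i < m := by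
  rw [wittEquiv_mem_wittFil_natCast_iff]
  constructor
  · intro h
    by_contra! hmi
    have := h m hmi
    rw [truncCoeff_truncX_pow, if_pos ⟨hm, rfl⟩] at this
    exact one_ne_zero this
  · intro h j hj
    rw [truncCoeff_truncX_pow, if_neg (by omega)]

omit [Fact (Nat.Prime p)] in
-- Each term of either product would need total degree at least `p`, so both sides are zero.
theorem mul_wittD_comm_of_mem_wittFil {i : ℕ} {f g : TruncPoly k p}
    (hx : wittEquiv k p f ∈ wittFil k p (p - 1 - i : ℕ)) (hy : wittEquiv k p g ∈ wittFil k p i) :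
    f * wittD k p g = g * wittD k p f := by
  rw [wittEquiv_mem_wittFil_natCast_iff] at hx hy
  refine truncPoly_ext fun n hn => ?_
  rw [truncCoeff_mul hn, truncCoeff_mul hn, Finset.sum_eq_zero, Finset.sum_eq_zero]
  · intro m hm
    rw [Finset.HasAntidiagonal.mem_antidiagonal] at hm
    by_cases h : m.1 ≤ i
    · rw [hy _ h, zero_mul]
    · rw [truncCoeff_wittD, hx _ (by omega), mul_zero, mul_zero]
  · intro m hm
    rw [Finset.HasAntidiagonal.mem_antidiagonal] at hm
    by_cases h : m.1 ≤ p - 1 - i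
    · rw [hx _ h, zero_mul]
    · rw [truncCoeff_wittD, hy _ (by omega), mul_zero, mul_zero]

theorem mk_mem_depPairs {i : ℕ} {x y : WittAlg k p} :
    (wittPair x y) ∈ depPairs k p i ↔ x ∈ nilFil k p i ∧ y ∈ nilFil k p i ∧
      ∃ s t : k, (s ≠ 0 ∨ t ≠ 0) ∧ s • x + t • y ∈ wittFil k p ((p - 1 - i : ℕ) : ℤ) :=
  Iff.rfl

theorem mk_mem_nilCommVar {f g : TruncPoly k p} :
    (wittPair (wittEquiv k p f) (wittEquiv k p g)) ∈ nilCommVar k p ↔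
      wittEquiv k p f ∈ nilVar k p ∧ wittEquiv k p g ∈ nilVar k p ∧
        f * wittD k p g = g * wittD k p f := by
  rw [← lie_wittEquiv_eq_zero_iff]
  rfl

theorem depPairs_swap {i : ℕ} {x y : WittAlg k p} (h : (wittPair x y) ∈ depPairs k p i) :
    (wittPair y x) ∈ depPairs k p i := by
  obtain ⟨hx, hy, s, t, hst, h⟩ := h
  exact ⟨hy, hx, t, s, hst.symm, by rwa [add_comm] at h⟩

/-- The combination `s f + t g` commutes with `g`, being zero for `i = 0` and by degree for `i > 0`.
When `s ≠ 0` it follows that `f` commutes with `g`, and the case `t ≠ 0` is symmetric. -/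
theorem depPairs_subset_nilCommVar (i : ℕ) : depPairs k p i ⊆ nilCommVar k p := by
  suffices ∀ f g : TruncPoly k p, ∀ s t : k, s ≠ 0 → wittEquiv k p g ∈ nilFil k p i →
      wittEquiv k p (s • f + t • g) ∈ wittFil k p ((p - 1 - i : ℕ) : ℤ) →
        f * wittD k p g = g * wittD k p f by
    rintro ⟨x, y⟩ hxy
    obtain ⟨f, rfl⟩ := (wittEquiv k p).surjective x
    obtain ⟨g, rfl⟩ := (wittEquiv k p).surjective y
    obtain ⟨hx, hy, s, t, hst, h⟩ := mk_mem_depPairs.1 hxy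
    rw [← map_smul, ← map_smul, ← map_add] at h
    refine mk_mem_nilCommVar.2 ⟨nilFil_subset_nilVar i hx, nilFil_subset_nilVar i hy, ?_⟩
    rcases hst with hs | ht
    · exact this f g s t hs hy h
    · exact (this g f t s ht hx (by rwa [add_comm] at h)).symm
  intro f g s t hs hg h
  have h2 : (s • f + t • g) * wittD k p g = g * wittD k p (s • f + t • g) := by
    by_cases hi : i = 0
    · rw [wittFil_eq_bot (by omega), Submodule.mem_bot, LinearEquiv.map_eq_zero_iff] at h
      rw [h, zero_mul, map_zero, mul_zero]
    · rw [nilFil_of_ne_zero hi] at hg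
      exact mul_wittD_comm_of_mem_wittFil h hg
  rw [Derivation.map_add, Derivation.map_smul, Derivation.map_smul, add_mul, mul_add, smul_mul_assoc,
    smul_mul_assoc, mul_smul_comm, mul_smul_comm, add_left_inj] at h2
  exact smul_right_injective _ hs h2

omit [Fact (Nat.Prime p)] in
/-- An element commuting with an element of order `o` is a multiple of it up to order `p - o`. -/
theorem exists_sub_smul_of_commute {o : ℕ} {f g : TruncPoly k p}
    (hf : ∀ j < o, truncCoeff k p j f = 0) (hfo : truncCoeff k p o f ≠ 0)
    (hfg : f * wittD k p g = g * wittD k p f) :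
    ∃ a : k, ∀ j, j + o ≤ p → truncCoeff k p j (g - a • f) = 0 := by
  refine ⟨truncCoeff k p o g / truncCoeff k p o f, truncCoeff_eq_zero_of_commute hf hfo ?_ ?_⟩
  · rw [Derivation.map_sub, Derivation.map_smul, mul_sub, sub_mul, hfg, mul_smul_comm, smul_mul_assoc]
  · rw [map_sub, map_smul, smul_eq_mul, div_mul_cancel₀ _ hfo, sub_self]

theorem mem_depPairs_of_order_zero {f g : TruncPoly k p} (hf : truncCoeff k p 0 f ≠ 0)
    (hfg : (wittPair (wittEquiv k p f) (wittEquiv k p g)) ∈ nilCommVar k p) :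
    (wittPair (wittEquiv k p f) (wittEquiv k p g)) ∈ depPairs k p 0 := by
  obtain ⟨a, ha⟩ := exists_sub_smul_of_commute (o := 0) (by simp) hf (mk_mem_nilCommVar.1 hfg).2.2
  have hg : g = a • f := by
    rw [← sub_eq_zero]
    exact truncPoly_ext fun n hn => by rw [ha n (by omega), map_zero]
  refine mk_mem_depPairs.2 ⟨by rw [nilFil_zero]; exact hfg.1, by rw [nilFil_zero]; exact hfg.2.1,
    -a, 1, Or.inr one_ne_zero, ?_⟩
  rw [hg, map_smul, one_smul, ← add_smul, neg_add_cancel, zero_smul]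
  exact Submodule.zero_mem _

theorem mem_depPairs_of_order_succ {i : ℕ} (hi0 : i ≠ 0) (hi : 2 * i + 1 ≤ p) {f g : TruncPoly k p}
    (hf : ∀ j < i + 1, truncCoeff k p j f = 0) (hfi : truncCoeff k p (i + 1) f ≠ 0)
    (hfg : f * wittD k p g = g * wittD k p f) :
    (wittPair (wittEquiv k p f) (wittEquiv k p g)) ∈ depPairs k p i := by
  obtain ⟨a, ha⟩ := exists_sub_smul_of_commute hf hfi hfg
  have hfm : wittEquiv k p f ∈ wittFil k p i := by
    rw [wittEquiv_mem_wittFil_natCast_iff]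
    exact fun j hj => hf j (by omega)
  have hgm : wittEquiv k p (g - a • f) ∈ wittFil k p (p - 1 - i : ℕ) := by
    rw [wittEquiv_mem_wittFil_natCast_iff]
    exact fun j hj => ha j (by omega)
  refine mk_mem_depPairs.2 ⟨by rwa [nilFil_of_ne_zero hi0], ?_, -a, 1, Or.inr one_ne_zero, ?_⟩
  · rw [nilFil_of_ne_zero hi0]
    have := Submodule.add_mem _ (wittFil_antitone (by omega) hgm) (Submodule.smul_mem _ a hfm)
    rwa [← map_smul, ← map_add, sub_add_cancel] at this
  · rwa [← map_smul, ← map_smul, ← map_add, neg_smul, one_smul, neg_add_eq_sub]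

omit [Fact (Nat.Prime p)] [CharP k p] in
theorem exists_order {f : TruncPoly k p} (hf : f ≠ 0) :
    ∃ o < p, (∀ j < o, truncCoeff k p j f = 0) ∧ truncCoeff k p o f ≠ 0 := by
  classical
  have h : ∃ o, truncCoeff k p o f ≠ 0 := by
    by_contra! h
    exact hf (truncPoly_ext fun n _ => by rw [h n, map_zero])
  refine ⟨Nat.find h, ?_, fun j hj => not_not.1 (Nat.find_min h hj), Nat.find_spec h⟩
  by_contra! hle
  exact Nat.find_spec h (truncCoeff_of_le hle f)

theorem exists_mem_depPairs_of_order_le {m : ℕ} (hm : p = 2 * m + 3) {o : ℕ} (ho : o ≤ m + 1)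
    {f g : TruncPoly k p} (hf : ∀ j < o, truncCoeff k p j f = 0) (hfo : truncCoeff k p o f ≠ 0)
    (hfg : (wittPair (wittEquiv k p f) (wittEquiv k p g)) ∈ nilCommVar k p) :
    ∃ i ≤ m, (wittPair (wittEquiv k p f) (wittEquiv k p g)) ∈ depPairs k p i := by
  obtain _ | _ | i := o
  · exact ⟨0, by omega, mem_depPairs_of_order_zero hfo hfg⟩
  -- Order one contradicts nilpotency of the first entry.
  · exact absurd ((wittEquiv_mem_nilVar_iff_of_nonunit (hf 0 one_pos)).1 hfg.1) hfo
  · exact ⟨i + 1, by omega, mem_depPairs_of_order_succ (by omega) (by omega) hf hfo (mk_mem_nilCommVar.1 hfg).2.2⟩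

/-- The sets `depPairs` are symmetric in the two entries, so it is enough that one entry has order
at most `m + 1`, or that both orders are larger. -/
theorem nilCommVar_eq_biUnion_depPairs {m : ℕ} (hm0 : m ≠ 0) (hm : p = 2 * m + 3) :
    nilCommVar k p = ⋃ i ∈ Finset.range (m + 1), depPairs k p i := by
  refine Set.Subset.antisymm ?_ (Set.iUnion₂_subset fun i _ => depPairs_subset_nilCommVar i)
  rintro ⟨x, y⟩ hxy
  change wittPair x y ∈ _ at hxy
  suffices ∃ i ≤ m, (wittPair x y) ∈ depPairs k p i by
    obtain ⟨i, hi, h⟩ := this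
    exact Set.mem_biUnion (Finset.mem_coe.2 (Finset.mem_range.2 (by omega))) h
  obtain ⟨f, rfl⟩ := (wittEquiv k p).surjective x
  obtain ⟨g, rfl⟩ := (wittEquiv k p).surjective y
  have hyx : (wittPair (wittEquiv k p g) (wittEquiv k p f)) ∈ nilCommVar k p := by
    have h := mk_mem_nilCommVar.1 hxy
    exact mk_mem_nilCommVar.2 ⟨h.2.1, h.1, h.2.2.symm⟩
  by_cases hf0 : f = 0
  · subst hf0
    refine ⟨0, by omega, mk_mem_depPairs.2 ⟨by rw [nilFil_zero]; exact hxy.1,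
      by rw [nilFil_zero]; exact hxy.2.1, 1, 0, Or.inl one_ne_zero, ?_⟩⟩
    rw [map_zero, smul_zero, zero_smul, add_zero]
    exact Submodule.zero_mem _
  by_cases hg0 : g = 0
  · subst hg0
    refine ⟨0, by omega, mk_mem_depPairs.2 ⟨by rw [nilFil_zero]; exact hxy.1,
      by rw [nilFil_zero]; exact hxy.2.1, 0, 1, Or.inr one_ne_zero, ?_⟩⟩
    rw [map_zero, smul_zero, zero_smul, add_zero]
    exact Submodule.zero_mem _
  obtain ⟨o, hop, ho, hfo⟩ := exists_order hf0
  obtain ⟨o', hop', ho', hgo⟩ := exists_order hg0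
  by_cases h1 : o ≤ m + 1
  · exact exists_mem_depPairs_of_order_le hm h1 ho hfo hxy
  by_cases h2 : o' ≤ m + 1
  · obtain ⟨i, hi, h⟩ := exists_mem_depPairs_of_order_le hm h2 ho' hgo hyx
    exact ⟨i, hi, depPairs_swap h⟩
  -- Both entries now lie in `𝔤_{m+1}`. As `p - 1 - m = m + 2`, the relation needed is one between
  -- the two coefficients of `X^(m+2)`.
  refine ⟨m, le_rfl, ?_⟩
  have hrel : ∃ s t : k, (s ≠ 0 ∨ t ≠ 0) ∧
      s * truncCoeff k p (m + 2) f + t * truncCoeff k p (m + 2) g = 0 := by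
    by_cases h : truncCoeff k p (m + 2) f = 0
    · exact ⟨1, 0, Or.inl one_ne_zero, by simp [h]⟩
    · exact ⟨-truncCoeff k p (m + 2) g, truncCoeff k p (m + 2) f, Or.inr h, by ring⟩
  obtain ⟨s, t, hst, h⟩ := hrel
  refine mk_mem_depPairs.2 ⟨?_, ?_, s, t, hst, ?_⟩
  · rw [nilFil_of_ne_zero hm0]
    exact (wittEquiv_mem_wittFil_natCast_iff m f).2 fun j hj => ho j (by omega)
  · rw [nilFil_of_ne_zero hm0]
    exact (wittEquiv_mem_wittFil_natCast_iff m g).2 fun j hj => ho' j (by omega)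
  · rw [← map_smul, ← map_smul, ← map_add, wittEquiv_mem_wittFil_natCast_iff]
    intro j hj
    rw [map_add, map_smul, map_smul, smul_eq_mul, smul_eq_mul]
    rcases (show j < m + 2 ∨ j = m + 2 by omega) with hlt | rfl
    · rw [ho j (by omega), ho' j (by omega), mul_zero, mul_zero, add_zero]
    · exact h

theorem depPairs_not_subset {i j : ℕ} (hij : i ≠ j) (hi : 2 * i + 3 ≤ p) (hj : 2 * j + 3 ≤ p) :
    ¬ depPairs k p j ⊆ depPairs k p i := by
  intro h
  rcases lt_or_gt_of_ne hij with hlt | hlt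
  · have hj0 : j ≠ 0 := by omega
    -- The second entry lies in `𝔤_{p-1-j}`, but both exponents are at most `p - 1 - i`, so the pair
    -- is independent modulo `𝔤_{p-1-i}`.
    have hmem : (wittPair (wittEquiv k p (truncX k p ^ (j + 1))) (wittEquiv k p (truncX k p ^ (p - j)))) ∈ depPairs k p j := by
      refine mk_mem_depPairs.2 ⟨?_, ?_, 0, 1, Or.inr one_ne_zero, ?_⟩
      · rw [nilFil_of_ne_zero hj0]
        exact (wittEquiv_truncX_pow_mem_wittFil_iff (by omega)).2 (by omega)
      · rw [nilFil_of_ne_zero hj0]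
        exact (wittEquiv_truncX_pow_mem_wittFil_iff (by omega)).2 (by omega)
      · rw [zero_smul, one_smul, zero_add]
        exact (wittEquiv_truncX_pow_mem_wittFil_iff (by omega)).2 (by omega)
    obtain ⟨-, -, s, t, hst, hmem⟩ := mk_mem_depPairs.1 (h hmem)
    rw [← map_smul, ← map_smul, ← map_add, wittEquiv_mem_wittFil_natCast_iff] at hmem
    have h1 := hmem (j + 1) (by omega)
    have h2 := hmem (p - j) (by omega)
    rw [map_add, map_smul, map_smul, truncCoeff_truncX_pow, truncCoeff_truncX_pow,
      if_pos ⟨by omega, rfl⟩, if_neg (by omega), smul_zero, add_zero, smul_eq_mul, mul_one] at h1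
    rw [map_add, map_smul, map_smul, truncCoeff_truncX_pow, truncCoeff_truncX_pow,
      if_neg (by omega), if_pos ⟨by omega, rfl⟩, smul_zero, zero_add, smul_eq_mul, mul_one] at h2
    exact hst.elim (fun hs => hs h1) fun ht => ht h2
  -- For `j < i`, a pair `(X^m D, 0)` of too small order has its first entry outside `𝔤_i`.
  · obtain ⟨m, hmp, hmj, hmi⟩ : ∃ m < p, wittEquiv k p (truncX k p ^ m) ∈ nilFil k p j ∧ m ≤ i := by
      by_cases hj0 : j = 0
      · refine ⟨0, by omega, ?_, by omega⟩
        rw [hj0, nilFil_zero, wittEquiv_mem_nilVar_iff, pow_zero, one_pow, ← pow_zero (truncX k p),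
          truncCoeff_truncX_pow, if_neg (by omega)]
      · refine ⟨j + 1, by omega, ?_, by omega⟩
        rw [nilFil_of_ne_zero hj0]
        exact (wittEquiv_truncX_pow_mem_wittFil_iff (by omega)).2 (by omega)
    have hmem : (wittPair (wittEquiv k p (truncX k p ^ m)) 0) ∈ depPairs k p j :=
      mk_mem_depPairs.2 ⟨hmj, zero_mem_nilFil j, 0, 1, Or.inr one_ne_zero, by
        rw [zero_smul, smul_zero, add_zero]
        exact Submodule.zero_mem _⟩
    have := (mk_mem_depPairs.1 (h hmem)).1
    rw [nilFil_of_ne_zero (by omega)] at this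
    have := (wittEquiv_truncX_pow_mem_wittFil_iff (k := k) (p := p) (m := m) (i := i) hmp).1 this
    omega

theorem isClosed_fst_mem_nilVar : IsClosed {z : WittPair k p | z.1 ∈ nilVar k p} := by
  have h : {z : WittPair k p | z.1 ∈ nilVar k p} =
      {z | truncCoeff k p (p - 1) ((wittEquiv k p).symm (wittFst k p z) ^ (p - 1)) = 0} := by
    ext z
    rw [Set.mem_ofPred_eq, Set.mem_ofPred_eq, ← wittEquiv_mem_nilVar_iff,
      LinearEquiv.apply_symm_apply]
    rfl
  rw [h]
  exact isClosed_zero_polyFun (k := k) (V := WittPair k p)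
    (((LinearMap.isPolyMap ((wittEquiv k p).symm.toLinearMap ∘ₗ wittFst k p)).pow (p - 1)) (truncCoeff k p (p - 1)))

theorem isClosed_snd_mem_nilVar : IsClosed {z : WittPair k p | z.2 ∈ nilVar k p} := by
  have hswap : IsPolyMap k (V := WittPair k p) (fun z : WittPair k p => wittPair (wittSnd k p z) (wittFst k p z)) :=
    isPolyMap_wittPair (LinearMap.isPolyMap _) (LinearMap.isPolyMap _)
  exact isClosed_fst_mem_nilVar.preimage hswap.continuous

theorem isClosed_depPairs (i : ℕ) : IsClosed (depPairs k p i) := by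
  have h1 : IsClosed {z : WittPair k p | z.1 ∈ nilFil k p i} := by
    by_cases hi : i = 0
    · simpa only [hi, nilFil_zero] using isClosed_fst_mem_nilVar
    · rw [nilFil_of_ne_zero hi]
      exact ((wittFil k p i).comap (wittFst k p)).isClosed_of_zariskiSpace k
  have h2 : IsClosed {z : WittPair k p | z.2 ∈ nilFil k p i} := by
    by_cases hi : i = 0
    · simpa only [hi, nilFil_zero] using isClosed_snd_mem_nilVar
    · rw [nilFil_of_ne_zero hi]
      exact ((wittFil k p i).comap (wittSnd k p)).isClosed_of_zariskiSpace k
  have h3 : IsClosed {z : WittPair k p | ∃ s t : k, (s ≠ 0 ∨ t ≠ 0) ∧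
      s • z.1 + t • z.2 ∈ wittFil k p ((p - 1 - i : ℕ) : ℤ)} := by
    have heq : {z : WittPair k p | ∃ s t : k, (s ≠ 0 ∨ t ≠ 0) ∧
        s • z.1 + t • z.2 ∈ wittFil k p ((p - 1 - i : ℕ) : ℤ)} =
        ⋂ φ ∈ (wittFil k p ((p - 1 - i : ℕ) : ℤ)).dualAnnihilator,
          ⋂ ψ ∈ (wittFil k p ((p - 1 - i : ℕ) : ℤ)).dualAnnihilator,
            {z : WittPair k p | φ z.1 * ψ z.2 - φ z.2 * ψ z.1 = 0} := by
      ext z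
      refine (exists_linear_relation_iff _ z.1 z.2).trans ?_
      simp only [Set.mem_iInter]
      rfl
    rw [heq]
    refine isClosed_biInter fun φ _ => isClosed_biInter fun ψ _ => ?_
    have hfst (l : Module.Dual k (WittAlg k p)) :
        (fun z : WittPair k p => l z.1) ∈ polyFun k (WittPair k p) := dual_mem_polyFun (l ∘ₗ wittFst k p)
    have hsnd (l : Module.Dual k (WittAlg k p)) :
        (fun z : WittPair k p => l z.2) ∈ polyFun k (WittPair k p) := dual_mem_polyFun (l ∘ₗ wittSnd k p)
    exact isClosed_zero_polyFun (k := k)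
      (sub_mem (mul_mem (hfst φ) (hsnd ψ)) (mul_mem (hsnd φ) (hfst ψ)))
  exact h1.inter (h2.inter h3)

end CommutingPairs

/-! ### Density of the strata in `depPairs`, and linear parametrizations. -/

section Strata

variable {k : Type*} [Field k] {p : ℕ} [Fact p.Prime] [CharP k p]

theorem commStratum_zero : commStratum k p 0 = {z | z.1 ∈ nilVar k p ∧ ∃ a : k, z.2 = a • z.1} :=
  if_pos rfl

theorem mk_mem_commStratum {i : ℕ} (hi : i ≠ 0) {x y : WittAlg k p} :
    (wittPair x y) ∈ commStratum k p i ↔ x ∈ nilVar k p ∧ y ∈ nilVar k p ∧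
      x ∈ wittFil k p i ∧ x ∉ wittFil k p (i + 1) ∧ ⁅x, y⁆ = 0 := by
  rw [commStratum, if_neg hi]
  rfl

theorem commStratum_subset_depPairs {i : ℕ} (hi : 2 * i + 3 ≤ p) :
    commStratum k p i ⊆ depPairs k p i := by
  rintro ⟨x, y⟩ h
  change wittPair x y ∈ _ at h
  change wittPair x y ∈ _
  by_cases hi0 : i = 0
  · subst hi0
    rw [commStratum_zero] at h
    obtain ⟨hx, a, hy⟩ := h
    change x ∈ nilVar k p at hx
    change y = a • x at hy
    refine mk_mem_depPairs.2 ⟨by rwa [nilFil_zero], ?_, -a, 1, Or.inr one_ne_zero, ?_⟩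
    · rw [nilFil_zero, hy]
      exact smul_mem_nilVar a hx
    · rw [hy, one_smul, ← add_smul, neg_add_cancel, zero_smul]
      exact Submodule.zero_mem _
  · obtain ⟨f, rfl⟩ := (wittEquiv k p).surjective x
    obtain ⟨g, rfl⟩ := (wittEquiv k p).surjective y
    obtain ⟨-, -, hf, hf', hfg⟩ := (mk_mem_commStratum hi0).1 h
    rw [lie_wittEquiv_eq_zero_iff] at hfg
    rw [wittEquiv_mem_wittFil_natCast_iff] at hf
    refine mem_depPairs_of_order_succ hi0 (by omega) (fun j hj => hf j (by omega)) ?_ hfg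
    intro h0
    refine hf' ?_
    have : wittEquiv k p f ∈ wittFil k p ((i + 1 : ℕ) : ℤ) := by
      rw [wittEquiv_mem_wittFil_natCast_iff]
      intro j hj
      rcases (show j ≤ i ∨ j = i + 1 by omega) with hji | rfl
      · exact hf j hji
      · exact h0
    simpa using this

theorem mk_mem_commStratum_of_mem_depPairs {i : ℕ} (hi : i ≠ 0) {x y : WittAlg k p}
    (h : (wittPair x y) ∈ depPairs k p i) (hx : x ∉ wittFil k p (i + 1)) :
    (wittPair x y) ∈ commStratum k p i := by
  have hc := depPairs_subset_nilCommVar i h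
  have hxi := (mk_mem_depPairs.1 h).1
  rw [nilFil_of_ne_zero hi] at hxi
  exact (mk_mem_commStratum hi).2 ⟨hc.1, hc.2.1, hxi, hx, hc.2.2⟩

variable [Infinite k]

theorem mem_closure_commStratum_of_ne_zero {i : ℕ} (hi : 2 * i + 3 ≤ p) {x y : WittAlg k p} {s t : k}
    (hx : x ∈ nilFil k p i) (hy : y ∈ nilFil k p i) (ht : t ≠ 0)
    (h : s • x + t • y ∈ wittFil k p ((p - 1 - i : ℕ) : ℤ)) :
    (wittPair x y) ∈ closure (commStratum k p i) := by
  by_cases hi0 : i = 0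
  · subst hi0
    rw [wittFil_eq_bot (by omega), Submodule.mem_bot] at h
    rw [nilFil_zero] at hx
    refine subset_closure ?_
    rw [commStratum_zero]
    refine ⟨hx, -(s / t), ?_⟩
    change y = -(s / t) • x
    obtain ⟨f, rfl⟩ := (wittEquiv k p).surjective x
    obtain ⟨g, rfl⟩ := (wittEquiv k p).surjective y
    rw [← map_smul, ← map_smul, ← map_add, LinearEquiv.map_eq_zero_iff] at h
    rw [← map_smul]
    congr 1
    have hg : t • g = -(s • f) := by rw [eq_neg_iff_add_eq_zero, add_comm, h]
    rw [← inv_smul_smul₀ ht g, hg, smul_neg, smul_smul, neg_smul, inv_mul_eq_div]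
  · by_cases hxi : x ∉ wittFil k p (i + 1)
    · exact subset_closure (mk_mem_commStratum_of_mem_depPairs hi0
        (mk_mem_depPairs.2 ⟨hx, hy, s, t, Or.inr ht, h⟩) hxi)
    rw [not_not] at hxi
    rw [nilFil_of_ne_zero hi0] at hx hy
    set v := wittEquiv k p (truncX k p ^ (i + 1)) with hv
    have hvi : v ∈ wittFil k p i := (wittEquiv_truncX_pow_mem_wittFil_iff (by omega)).2 (by omega)
    -- The direction is chosen so that `s x + t y` stays fixed, while the first entry acquires the
    -- coefficient `τ` at `X^(i+1)` and leaves `𝔤_{i+1}`.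
    refine mem_of_forall_line_mem k isClosed_closure _
      (wittPair v (-(s / t) • v)) fun τ hτ => subset_closure ?_
    change (wittPair (x + τ • v) (y + τ • -(s / t) • v)) ∈ commStratum k p i
    refine mk_mem_commStratum_of_mem_depPairs hi0 (mk_mem_depPairs.2 ⟨?_, ?_, s, t, Or.inr ht, ?_⟩) ?_
    · rw [nilFil_of_ne_zero hi0]
      exact Submodule.add_mem _ hx (Submodule.smul_mem _ _ hvi)
    · rw [nilFil_of_ne_zero hi0]
      exact Submodule.add_mem _ hy (Submodule.smul_mem _ _ (Submodule.smul_mem _ _ hvi))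
    · have h1 : s • (x + τ • v) + t • (y + τ • -(s / t) • v) = s • x + t • y := by
        rw [smul_add, smul_add, add_add_add_comm, smul_smul, smul_smul, smul_smul, ← add_smul,
          show s * τ + t * τ * -(s / t) = 0 by field_simp; ring, zero_smul, add_zero]
      rwa [h1]
    · intro h'
      obtain ⟨f, rfl⟩ := (wittEquiv k p).surjective x
      rw [hv, ← map_smul, ← map_add, ← Nat.cast_add_one, wittEquiv_mem_wittFil_natCast_iff] at h'
      rw [← Nat.cast_add_one, wittEquiv_mem_wittFil_natCast_iff] at hxi
      have h1 := h' (i + 1) le_rfl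
      rw [map_add, map_smul, hxi (i + 1) le_rfl, truncCoeff_truncX_pow, if_pos ⟨by omega, rfl⟩,
        zero_add, smul_eq_mul, mul_one] at h1
      exact hτ h1

theorem depPairs_subset_commClosure {i : ℕ} (hi : 2 * i + 3 ≤ p) :
    depPairs k p i ⊆ commClosure k p i := by
  rintro ⟨x, y⟩ hxy
  obtain ⟨hx, hy, s, t, hst, h⟩ := mk_mem_depPairs.1 hxy
  by_cases ht : t ≠ 0
  · exact mem_closure_commStratum_of_ne_zero hi hx hy ht h
  rw [not_not] at ht
  have hs : s ≠ 0 := hst.resolve_right (not_not.2 ht)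
  rw [ht, zero_smul, add_zero, Submodule.smul_mem_iff _ hs] at h
  -- When `t = 0`, the first entry itself lies in `𝔤_{p-1-i}`. Replacing `x` by `x + τ y` gives a
  -- pair satisfying the relation `(1, -τ)`, whose second coefficient is nonzero.
  refine mem_of_forall_line_mem k isClosed_closure _ (wittPair y 0) fun τ hτ => ?_
  have heq : (wittPair x y) + τ • (wittPair y 0) =
      (wittPair (x + τ • y) y) := by
    change wittPair (x + τ • y) (y + τ • 0) = wittPair (x + τ • y) y
    rw [smul_zero, add_zero]
  change wittPair x y + τ • wittPair y 0 ∈ _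
  rw [heq]
  refine mem_closure_commStratum_of_ne_zero (s := 1) (t := -τ) hi ?_ hy (neg_ne_zero.2 hτ) ?_
  · by_cases hi0 : i = 0
    · subst hi0
      rw [wittFil_eq_bot (by omega), Submodule.mem_bot] at h
      rw [nilFil_zero] at hy ⊢
      rw [h, zero_add]
      exact smul_mem_nilVar τ hy
    · rw [nilFil_of_ne_zero hi0] at hx hy ⊢
      exact Submodule.add_mem _ hx (Submodule.smul_mem _ _ hy)
  · rw [one_smul, add_assoc, ← add_smul, add_neg_cancel, zero_smul, add_zero]
    exact h

theorem commClosure_eq_depPairs {i : ℕ} (hi : 2 * i + 3 ≤ p) :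
    commClosure k p i = depPairs k p i :=
  Set.Subset.antisymm (closure_minimal (commStratum_subset_depPairs hi) (isClosed_depPairs i))
    (depPairs_subset_commClosure hi)

variable (k p) in
/-- The filtration of the truncated polynomial algebra corresponding to `wittFil`. -/
def truncFil (i : ℕ) : Submodule k (TruncPoly k p) :=
  (wittFil k p i).comap (wittEquiv k p).toLinearMap

omit [Fact (Nat.Prime p)] [Infinite k] in
theorem mem_truncFil {i : ℕ} {f : TruncPoly k p} :
    f ∈ truncFil k p i ↔ wittEquiv k p f ∈ wittFil k p i :=
  Iff.rfl

omit [Fact p.Prime] [Infinite k] in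
theorem finrank_truncFil {i : ℕ} (hi : i < p) : Module.finrank k (truncFil k p i) = p - 1 - i := by
  let c : truncFil k p i →ₗ[k] (Fin (p - 1 - i) → k) :=
    (LinearMap.pi fun j : Fin (p - 1 - i) => truncCoeff k p (i + 1 + (j : ℕ))) ∘ₗ
      (truncFil k p i).subtype
  have hc : Function.Bijective c := by
    constructor
    · rintro ⟨f, hf⟩ ⟨g, hg⟩ h
      rw [mem_truncFil, wittEquiv_mem_wittFil_natCast_iff] at hf hg
      refine Subtype.ext (truncPoly_ext fun n hn => ?_)
      by_cases hni : n ≤ i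
      · rw [hf n hni, hg n hni]
      · have h1 : truncCoeff k p (i + 1 + (n - (i + 1))) f =
            truncCoeff k p (i + 1 + (n - (i + 1))) g := congrFun h ⟨n - (i + 1), by omega⟩
        rwa [show i + 1 + (n - (i + 1)) = n by omega] at h1
    · intro c
      refine ⟨⟨truncOfCoeff k p fun n =>
        if h : i < n ∧ n < p then c ⟨n - (i + 1), by omega⟩ else 0, ?_⟩, ?_⟩
      · rw [mem_truncFil, wittEquiv_mem_wittFil_natCast_iff]
        intro j hj
        rw [truncCoeff_truncOfCoeff, dif_neg (by omega), ite_self]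
      · funext j
        have := j.2
        change truncCoeff k p (i + 1 + (j : ℕ)) (truncOfCoeff k p _) = _
        rw [truncCoeff_truncOfCoeff, if_pos (by omega), dif_pos ⟨by omega, by omega⟩]
        congr 1
        exact Fin.ext (by simp)
  rw [LinearEquiv.finrank_eq (LinearEquiv.ofBijective c hc), Module.finrank_fin_fun]

/-- For `i ≥ 1`, a dense parametrization of the `i`-th component by an affine space of
dimension `p`. -/
theorem closure_range_param_eq_depPairs {i : ℕ} (hi0 : i ≠ 0) (hi : 2 * i + 3 ≤ p) :
    closure (Set.range fun w : truncFil k p i × k × truncFil k p (p - 1 - i) =>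
      wittPair (wittEquiv k p w.1) (w.2.1 • wittEquiv k p w.1 + wittEquiv k p w.2.2)) =
      depPairs k p i := by
  refine Set.Subset.antisymm (closure_minimal ?_ (isClosed_depPairs i)) ?_
  · rintro _ ⟨⟨⟨f, hx⟩, a, g, hz⟩, rfl⟩
    rw [mem_truncFil] at hx hz
    refine mk_mem_depPairs.2 ⟨by rwa [nilFil_of_ne_zero hi0], ?_, -a, 1, Or.inr one_ne_zero, ?_⟩
    · rw [nilFil_of_ne_zero hi0]
      exact Submodule.add_mem _ (Submodule.smul_mem _ _ hx) (wittFil_antitone (by omega) hz)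
    · rwa [one_smul, ← add_assoc, ← add_smul, neg_add_cancel, zero_smul, zero_add]
  · rw [← commClosure_eq_depPairs hi]
    refine closure_mono ?_
    rintro ⟨x, y⟩ h
    obtain ⟨hx, hy, s, t, hst, hU⟩ := mk_mem_depPairs.1 (commStratum_subset_depPairs hi h)
    obtain ⟨-, -, hxi, hxi', -⟩ := (mk_mem_commStratum hi0).1 h
    -- If `t = 0`, then `x` lies in `𝔤_{p-1-i}`, which is contained in `𝔤_{i+1}`.
    have ht : t ≠ 0 := by
      rintro rfl
      rw [zero_smul, add_zero, Submodule.smul_mem_iff _ (hst.resolve_right (by simp))] at hU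
      exact hxi' (wittFil_antitone (by omega) hU)
    obtain ⟨f, rfl⟩ := (wittEquiv k p).surjective x
    obtain ⟨g, rfl⟩ := (wittEquiv k p).surjective y
    rw [← map_smul, ← map_smul, ← map_add] at hU
    refine ⟨(⟨f, hxi⟩, -(s / t), ⟨t⁻¹ • (s • f + t • g), Submodule.smul_mem _ _ hU⟩), ?_⟩
    change wittPair (wittEquiv k p f)
      (-(s / t) • wittEquiv k p f + wittEquiv k p (t⁻¹ • (s • f + t • g))) = wittPair _ _
    congr 1
    rw [← map_smul, ← map_add]
    congr 1
    rw [smul_add, smul_smul, inv_smul_smul₀ ht, ← add_assoc, ← add_smul, inv_mul_eq_div,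
      neg_add_cancel, zero_smul, zero_add]

end Strata

/-! ### Irreducibility and exact dimension of each `depPairs`. -/

section Components

variable {k : Type*} [Field k] [IsAlgClosed k] {p : ℕ} [Fact p.Prime] [CharP k p]

omit [IsAlgClosed k] [Fact (Nat.Prime p)] in
theorem IsPolyMap.wittEquiv {W : Type*} [AddCommGroup W] [Module k W] {φ : W → TruncPoly k p}
    (hφ : IsPolyMap k φ) : IsPolyMap k (fun w => wittEquiv k p (φ w)) := fun l =>
  hφ (l ∘ₗ (_root_.wittEquiv k p).toLinearMap)

/-- A dense parametrization of the component of index zero by an affine space of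
dimension `p`. -/
theorem closure_range_pow_eq_depPairs_zero (hp : 3 ≤ p) :
    closure (Set.range fun w : LinearMap.ker (truncCoeff k p (p - 1)) × k =>
      (wittPair (wittEquiv k p ((w.1 : TruncPoly k p) ^ (p - 1))) (w.2 • wittEquiv k p ((w.1 : TruncPoly k p) ^ (p - 1))))) =
      depPairs k p 0 := by
  have : Infinite k := IsAlgClosed.instInfinite
  refine Set.Subset.antisymm (closure_minimal ?_ (isClosed_depPairs 0)) ?_
  · rintro _ ⟨⟨⟨h, hh⟩, a⟩, rfl⟩
    refine commStratum_subset_depPairs (by omega) ?_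
    rw [commStratum_zero]
    exact ⟨wittEquiv_pow_pred_mem_nilVar hh, a, rfl⟩
  · rw [← commClosure_eq_depPairs (by omega)]
    refine closure_minimal ?_ isClosed_closure
    rintro ⟨x, y⟩ h
    rw [commStratum_zero] at h
    obtain ⟨hx, a, hy⟩ := h
    change y = a • x at hy
    change x ∈ nilVar k p at hx
    subst hy
    obtain ⟨f, rfl⟩ := (wittEquiv k p).surjective x
    refine (mem_closure_iff_polyFun k).2 ?_
    intro F hF hF0
    have hφ : IsPolyMap k (V := WittPair k p)
        (fun f : TruncPoly k p => wittPair (wittEquiv k p f) (a • wittEquiv k p f)) :=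
      have h : IsPolyMap k (wittEquiv k p) := (LinearMap.isPolyMap LinearMap.id).wittEquiv
      isPolyMap_wittPair h (IsPolyMap.smul (const_mem_polyFun a) h)
    -- For fixed `a`, density in `𝒩` reduces the claim to `f(0) ≠ 0`, where a `(p-1)`-th root of `f`
    -- in the hyperplane exists.
    refine eq_zero_on_nilVar (by omega) (hφ.comp_mem hF) (fun g hg0 hg => ?_) hx
    obtain ⟨h, hh, rfl⟩ := exists_pow_pred_eq_of_mem_nilVar hg0 hg
    exact hF0 _ ⟨(⟨h, hh⟩, a), rfl⟩

/-- Both claims come from the dense parametrizations. The sources have dimension `(p - 1) + 1` for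
`i = 0` and `(p - 1 - i) + 1 + i` for `i > 0`. -/
theorem isIrreducible_depPairs_and_dim_le {i : ℕ} (hi : 2 * i + 3 ≤ p) :
    IsIrreducible (depPairs k p i) ∧ topologicalKrullDim (depPairs k p i) ≤ p := by
  have : Infinite k := IsAlgClosed.instInfinite
  by_cases hi0 : i = 0
  · subst hi0
    have hpow : IsPolyMap k (fun w : LinearMap.ker (truncCoeff k p (p - 1)) × k =>
        wittEquiv k p ((w.1 : TruncPoly k p) ^ (p - 1))) :=
      IsPolyMap.wittEquiv ((LinearMap.isPolyMap ((LinearMap.ker (truncCoeff k p (p - 1))).subtype ∘ₗ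
        LinearMap.fst k _ k)).pow (p - 1))
    have hφ := isPolyMap_wittPair hpow
      (IsPolyMap.smul (dual_mem_polyFun (LinearMap.snd k (LinearMap.ker (truncCoeff k p (p - 1))) k)) hpow)
    rw [← closure_range_pow_eq_depPairs_zero (by omega)]
    refine ⟨hφ.isIrreducible_range.closure, hφ.topologicalKrullDim_closure_range_le.trans ?_⟩
    have hne : truncCoeff k p (p - 1) ≠ 0 := by
      intro h0
      have := truncCoeff_truncX_pow (k := k) (p := p) (p - 1) (p - 1)
      rw [h0, if_pos ⟨by omega, rfl⟩] at this
      exact zero_ne_one this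
    have h1 := Module.Dual.finrank_ker_add_one_of_ne_zero hne
    rw [LinearEquiv.finrank_eq (truncEquiv k p), Module.finrank_fin_fun] at h1
    rw [Module.finrank_prod, Module.finrank_self, h1]
  · have h1 : IsPolyMap k (fun w : truncFil k p i × k × truncFil k p (p - 1 - i) =>
        wittEquiv k p w.1) :=
      IsPolyMap.wittEquiv (LinearMap.isPolyMap ((truncFil k p i).subtype ∘ₗ
        LinearMap.fst k _ (k × truncFil k p (p - 1 - i))))
    have h2 : IsPolyMap k (fun w : truncFil k p i × k × truncFil k p (p - 1 - i) =>
        wittEquiv k p w.2.2) :=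
      IsPolyMap.wittEquiv (LinearMap.isPolyMap ((truncFil k p (p - 1 - i)).subtype ∘ₗ
        LinearMap.snd k k (truncFil k p (p - 1 - i)) ∘ₗ LinearMap.snd k (truncFil k p i) _))
    have h3 : (fun w : truncFil k p i × k × truncFil k p (p - 1 - i) => w.2.1) ∈ polyFun k _ :=
      dual_mem_polyFun (LinearMap.fst k k (truncFil k p (p - 1 - i)) ∘ₗ
        LinearMap.snd k (truncFil k p i) _)
    have hφ := isPolyMap_wittPair h1 ((IsPolyMap.smul h3 h1).add h2)
    rw [← closure_range_param_eq_depPairs hi0 hi]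
    refine ⟨hφ.isIrreducible_range.closure, hφ.topologicalKrullDim_closure_range_le.trans ?_⟩
    rw [Module.finrank_prod, Module.finrank_prod, Module.finrank_self, finrank_truncFil (by omega),
      finrank_truncFil (by omega)]
    exact_mod_cast (show p - 1 - i + (1 + (p - 1 - (p - 1 - i))) ≤ p by omega)

/-- The space of pairs with entries in given subspaces. -/
def pairSubmodule (A B : Submodule k (TruncPoly k p)) : Submodule k (WittPair k p) :=
  A.comap ((wittEquiv k p).symm.toLinearMap ∘ₗ wittFst k p) ⊓
    B.comap ((wittEquiv k p).symm.toLinearMap ∘ₗ wittSnd k p)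

omit [IsAlgClosed k] [Fact (Nat.Prime p)] in
theorem mk_mem_pairSubmodule {A B : Submodule k (TruncPoly k p)} {f g : TruncPoly k p} :
    wittPair (wittEquiv k p f) (wittEquiv k p g) ∈ pairSubmodule A B ↔ f ∈ A ∧ g ∈ B := by
  change (wittEquiv k p).symm (wittEquiv k p f) ∈ A ∧ (wittEquiv k p).symm (wittEquiv k p g) ∈ B ↔ _
  rw [LinearEquiv.symm_apply_apply, LinearEquiv.symm_apply_apply]

omit [IsAlgClosed k] [Fact p.Prime] in
theorem finrank_pairSubmodule (A B : Submodule k (TruncPoly k p)) :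
    Module.finrank k (pairSubmodule A B) = Module.finrank k A + Module.finrank k B := by
  rw [← Module.finrank_prod]
  let φ : pairSubmodule A B →ₗ[k] A × B :=
    (((wittEquiv k p).symm.toLinearMap ∘ₗ wittFst k p).restrict (p := pairSubmodule A B) (q := A)
      fun _ hz => hz.1).prod
    (((wittEquiv k p).symm.toLinearMap ∘ₗ wittSnd k p).restrict (p := pairSubmodule A B) (q := B)
      fun _ hz => hz.2)
  refine LinearEquiv.finrank_eq (LinearEquiv.ofBijective φ ⟨?_, ?_⟩)
  · rintro ⟨⟨x, y⟩, hz⟩ ⟨⟨x', y'⟩, hz'⟩ h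
    have h1 : (wittEquiv k p).symm x = (wittEquiv k p).symm x' :=
      congrArg (fun w : A × B => (w.1 : TruncPoly k p)) h
    have h2 : (wittEquiv k p).symm y = (wittEquiv k p).symm y' :=
      congrArg (fun w : A × B => (w.2 : TruncPoly k p)) h
    exact Subtype.ext (Prod.ext ((wittEquiv k p).symm.injective h1) ((wittEquiv k p).symm.injective h2))
  · rintro ⟨⟨f, hf⟩, g, hg⟩
    refine ⟨⟨wittPair (wittEquiv k p f) (wittEquiv k p g), mk_mem_pairSubmodule.2 ⟨hf, hg⟩⟩, ?_⟩
    exact Prod.ext (Subtype.ext ((wittEquiv k p).symm_apply_apply f))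
      (Subtype.ext ((wittEquiv k p).symm_apply_apply g))

omit [IsAlgClosed k] in
theorem diag_mem_depPairs {i : ℕ} {x : WittAlg k p} (hx : x ∈ nilFil k p i) :
    wittPair x x ∈ depPairs k p i := by
  refine mk_mem_depPairs.2 ⟨hx, hx, -1, 1, Or.inr one_ne_zero, ?_⟩
  rw [← add_smul, neg_add_cancel, zero_smul]
  exact Submodule.zero_mem _

/-- The chain is `𝔤_1 × 0 ⊂ 𝒩 × 0 ⊂ depPairs k p 0`, starting from a linear space of dimension `p -
2`. The strict inclusions are witnessed by `(D, 0)` and `(D, D)`. -/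
theorem le_topologicalKrullDim_depPairs_zero (hp : 3 ≤ p) :
    (p : WithBot ℕ∞) ≤ topologicalKrullDim (depPairs k p 0) := by
  have : Infinite k := IsAlgClosed.instInfinite
  have hirr := (isIrreducible_depPairs_and_dim_le (k := k) (p := p) (i := 0) (by omega)).1
  let L : Submodule k (WittPair k p) := pairSubmodule (truncFil k p 1) ⊥
  have hL : Module.finrank k L = p - 2 := by
    rw [finrank_pairSubmodule, finrank_truncFil (by omega), finrank_bot]
    omega
  have h1 := finrank_le_topologicalKrullDim (p - 2) L hL
  let T : Set (WittPair k p) := {z | z.1 ∈ nilVar k p} ∩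
    ((⊥ : Submodule k (WittAlg k p)).comap (wittSnd k p) : Submodule k (WittPair k p))
  have hTd : T ⊆ depPairs k p 0 := by
    rintro ⟨x, y⟩ ⟨hx, hy⟩
    change y = 0 at hy
    subst hy
    refine mk_mem_depPairs.2 ⟨by rw [nilFil_zero]; exact hx, zero_mem_nilFil 0, 0, 1,
      Or.inr one_ne_zero, ?_⟩
    rw [zero_smul, smul_zero, add_zero]
    exact Submodule.zero_mem _
  have hTc : IsClosed T := isClosed_fst_mem_nilVar.inter (Submodule.isClosed_of_zariskiSpace k _)
  have hproj : IsPolyMap k (V := WittPair k p)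
      (fun z : WittPair k p => wittPair (wittFst k p z) ((0 : WittPair k p →ₗ[k] WittAlg k p) z)) :=
    isPolyMap_wittPair (LinearMap.isPolyMap _) (LinearMap.isPolyMap _)
  -- The set `𝒩 × 0` is the image of the irreducible `depPairs k p 0` under `(x, y) ↦ (x, 0)`.
  have hTi : IsIrreducible T := by
    have himg := hirr.image _ hproj.continuous.continuousOn
    convert himg using 1
    ext ⟨x, y⟩
    constructor
    · rintro h
      obtain ⟨hx, hy⟩ := id h
      change y = 0 at hy
      subst hy
      exact ⟨(x, 0), hTd h, rfl⟩
    · rintro ⟨z, hz, h⟩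
      rw [← h]
      have := hz.1
      rw [nilFil_zero] at this
      exact ⟨this, rfl⟩
  have hD : wittEquiv k p (truncX k p ^ 0) ∈ nilVar k p := by
    rw [wittEquiv_mem_nilVar_iff, pow_zero, one_pow, ← pow_zero (truncX k p),
      truncCoeff_truncX_pow, if_neg (by omega)]
  have hLT : (L : Set (WittPair k p)) ⊂ T := by
    constructor
    · rintro ⟨x, y⟩ hz
      obtain ⟨f, rfl⟩ := (wittEquiv k p).surjective x
      obtain ⟨g, rfl⟩ := (wittEquiv k p).surjective y
      obtain ⟨hf, hg⟩ := mk_mem_pairSubmodule.1 hz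
      rw [Submodule.mem_bot] at hg
      refine ⟨wittFil_subset_nilVar one_ne_zero (mem_truncFil.1 hf), ?_⟩
      rw [hg, map_zero]
      rfl
    intro h
    have h2 := @h (wittPair (wittEquiv k p (truncX k p ^ 0)) 0) ⟨hD, rfl⟩
    rw [← map_zero (wittEquiv k p)] at h2
    have h2 := mem_truncFil.1 (mk_mem_pairSubmodule.1 h2).1
    rw [wittEquiv_truncX_pow_mem_wittFil_iff (by omega)] at h2
    omega
  have hTE : T ⊂ depPairs k p 0 := by
    refine ⟨hTd, fun h => ?_⟩
    have h2 := diag_mem_depPairs (show wittEquiv k p (truncX k p ^ 0) ∈ nilFil k p 0 by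
      rwa [nilFil_zero])
    have h3 : wittEquiv k p (truncX k p ^ 0) = 0 := (h h2).2
    rw [LinearEquiv.map_eq_zero_iff] at h3
    have h4 := truncCoeff_truncX_pow (k := k) (p := p) 0 0
    rw [h3, map_zero, if_pos ⟨by omega, rfl⟩] at h4
    exact zero_ne_one h4
  have h2 := add_one_le_topologicalKrullDim (L.isClosed_of_zariskiSpace k) hLT hTi h1
  have h3 := add_one_le_topologicalKrullDim hTc hTE hirr h2
  rwa [show p - 2 + 1 + 1 = p by omega] at h3

/-- The linear space `𝔤_i × 𝔤_{p-1-i}` has dimension `p - 1` and is a proper closed subset, since it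
misses a diagonal pair. -/
theorem le_topologicalKrullDim_depPairs_of_ne_zero {i : ℕ} (hi0 : i ≠ 0) (hi : 2 * i + 3 ≤ p) :
    (p : WithBot ℕ∞) ≤ topologicalKrullDim (depPairs k p i) := by
  have : Infinite k := IsAlgClosed.instInfinite
  have hirr := (isIrreducible_depPairs_and_dim_le (k := k) hi).1
  let L : Submodule k (WittPair k p) :=
    pairSubmodule (truncFil k p i) (truncFil k p (p - 1 - i))
  have hL : Module.finrank k L = p - 1 := by
    rw [finrank_pairSubmodule, finrank_truncFil (by omega), finrank_truncFil (by omega)]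
    omega
  have h1 := finrank_le_topologicalKrullDim (p - 1) L hL
  have hLE : (L : Set (WittPair k p)) ⊂ depPairs k p i := by
    constructor
    · rintro ⟨x, y⟩ hz
      obtain ⟨f, rfl⟩ := (wittEquiv k p).surjective x
      obtain ⟨g, rfl⟩ := (wittEquiv k p).surjective y
      obtain ⟨hx, hy⟩ := mk_mem_pairSubmodule.1 hz
      rw [mem_truncFil] at hx hy
      refine mk_mem_depPairs.2 ⟨by rwa [nilFil_of_ne_zero hi0], ?_, 0, 1, Or.inr one_ne_zero, ?_⟩
      · rw [nilFil_of_ne_zero hi0]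
        exact wittFil_antitone (by omega) hy
      · rwa [zero_smul, one_smul, zero_add]
    · intro h
      have hv : wittEquiv k p (truncX k p ^ (i + 1)) ∈ wittFil k p i :=
        (wittEquiv_truncX_pow_mem_wittFil_iff (by omega)).2 (by omega)
      have h2 := diag_mem_depPairs (show wittEquiv k p (truncX k p ^ (i + 1)) ∈ nilFil k p i by
        rwa [nilFil_of_ne_zero hi0])
      have h3 := mem_truncFil.1 (mk_mem_pairSubmodule.1 (h h2)).2
      rw [wittEquiv_truncX_pow_mem_wittFil_iff (by omega)] at h3
      omega
  have h2 := add_one_le_topologicalKrullDim (L.isClosed_of_zariskiSpace k) hLE hirr h1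
  rwa [show p - 1 + 1 = p by omega] at h2

theorem topologicalKrullDim_depPairs {i : ℕ} (hi : 2 * i + 3 ≤ p) :
    topologicalKrullDim (depPairs k p i) = p :=
  le_antisymm (isIrreducible_depPairs_and_dim_le hi).2 <| by
    by_cases hi0 : i = 0
    · subst hi0
      exact le_topologicalKrullDim_depPairs_zero (by omega)
    · exact le_topologicalKrullDim_depPairs_of_ne_zero hi0 hi

end Components

end

/-! ### The decomposition of the nilpotent commuting variety. -/

theorem theorem1 (k : Type*) [Field k] [IsAlgClosed k] (p : ℕ) [Fact p.Prime] [CharP k p]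
    (hp : 3 < p) :
    -- the variety is reducible
    ¬ IsIrreducible (nilCommVar k p) ∧
    -- its irreducible components are exactly the closed sets of index `0 ≤ i ≤ (p - 3) / 2`
    (fun Z : Set (nilCommVar k p) => (Subtype.val '' Z : Set (WittPair k p))) ''
        irreducibleComponents (nilCommVar k p)
      = commClosure k p '' {i | i ≤ (p - 3) / 2} ∧
    -- these are pairwise distinct, so there are `(p - 1) / 2` components
    Set.InjOn (commClosure k p) {i | i ≤ (p - 3) / 2} ∧
    (irreducibleComponents (nilCommVar k p)).ncard = (p - 1) / 2 ∧
    -- the variety is the union of these closed sets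
    nilCommVar k p = ⋃ i ∈ {i : ℕ | i ≤ (p - 3) / 2}, commClosure k p i ∧
    -- it is equidimensional of dimension `p`
    (∀ Z ∈ irreducibleComponents (nilCommVar k p), topologicalKrullDim Z = p) ∧
    (∀ i ≤ (p - 3) / 2, topologicalKrullDim (commClosure k p i) = p) ∧
    topologicalKrullDim (nilCommVar k p) = p := by

  have hprime : p.Prime := Fact.out
  obtain ⟨m, hm⟩ : ∃ m, p = 2 * m + 3 := by
    obtain ⟨n, hn⟩ := hprime.odd_of_ne_two (by omega)
    exact ⟨n - 1, by omega⟩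
  -- This is where `p > 3` enters: there are at least two pieces, and the last piece is of the
  -- linear type.
  have hm0 : m ≠ 0 := by omega
  have hpm : (p - 3) / 2 = m := by omega
  have : Infinite k := IsAlgClosed.instInfinite
  rw [hpm, show (p - 1) / 2 = m + 1 by omega]
  have hmem (i : ℕ) (hi : i ∈ Finset.range (m + 1)) : 2 * i + 3 ≤ p := by
    rw [Finset.mem_range] at hi
    omega
  have hset : {i | i ≤ m} = (Finset.range (m + 1) : Set ℕ) := by
    ext i
    simp
  have hcl (i : ℕ) (hi : i ∈ Finset.range (m + 1)) : commClosure k p i = depPairs k p i :=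
    commClosure_eq_depPairs (hmem i hi)
  have hclosed : ∀ i ∈ Finset.range (m + 1), IsClosed (commClosure k p i) :=
    fun i _ => isClosed_closure
  have hirr : ∀ i ∈ Finset.range (m + 1), IsIrreducible (commClosure k p i) := fun i hi => by
    rw [hcl i hi]
    exact (isIrreducible_depPairs_and_dim_le (hmem i hi)).1
  have hdim : ∀ i ∈ Finset.range (m + 1), topologicalKrullDim (commClosure k p i) = p :=
    fun i hi => by
      rw [hcl i hi]
      exact topologicalKrullDim_depPairs (hmem i hi)
  have hinc : ∀ i ∈ Finset.range (m + 1), ∀ j ∈ Finset.range (m + 1),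
      commClosure k p i ⊆ commClosure k p j → i = j := fun i hi j hj h => by
    by_contra hij
    rw [hcl i hi, hcl j hj] at h
    exact depPairs_not_subset (Ne.symm hij) (hmem j hj) (hmem i hi) h
  have hcover : nilCommVar k p = ⋃ i ∈ Finset.range (m + 1), commClosure k p i := by
    rw [nilCommVar_eq_biUnion_depPairs hm0 hm]
    exact Set.iUnion₂_congr fun i hi => (hcl i hi).symm
  have hcomp := image_irreducibleComponents_biUnion hclosed hirr hinc hcover
  have hinj : Set.InjOn (commClosure k p) (Finset.range (m + 1)) := fun i hi j hj h =>
    hinc i hi j hj h.subset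
  have hsub (i : ℕ) (hi : i ∈ Finset.range (m + 1)) : commClosure k p i ⊆ nilCommVar k p := by
    rw [hcover]
    exact Set.subset_biUnion_of_mem (u := commClosure k p) hi
  have h0 : 0 ∈ Finset.range (m + 1) := Finset.mem_range.2 (by omega)
  have h1 : 1 ∈ Finset.range (m + 1) := Finset.mem_range.2 (by omega)
  rw [hset]
  refine ⟨fun h => ?_, hcomp, hinj, ?_, hcover, fun Z hZ => ?_, fun i hi => ?_, ?_⟩
  -- An irreducible variety would lie in a single piece, which would then contain the pieces of
  -- index 0 and 1.
  · obtain ⟨i, hi, hle⟩ := h.exists_subset_of_subset_biUnion hclosed hcover.subset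
    have e0 := hinc 0 h0 i hi ((hsub 0 h0).trans hle)
    have e1 := hinc 1 h1 i hi ((hsub 1 h1).trans hle)
    omega
  · rw [← Set.ncard_image_of_injective _ Subtype.val_injective.image_injective, hcomp,
      hinj.ncard_image, Set.ncard_coe_finset, Finset.card_range]
  · have hZ' : (Subtype.val '' Z : Set (WittPair k p)) ∈
        commClosure k p '' (Finset.range (m + 1) : Set ℕ) := hcomp ▸ ⟨Z, hZ, rfl⟩
    obtain ⟨i, hi, h⟩ := hZ'
    rw [← topologicalKrullDim_image_subtypeVal, ← h]
    exact hdim i hi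
  · exact hdim i (Finset.mem_range.2 (by omega))
  · refine le_antisymm (topologicalKrullDim_biUnion_le hclosed hcover fun i hi => (hdim i hi).le) ?_
    rw [← hdim 0 h0]
    exact (Topology.IsEmbedding.inclusion (hsub 0 h0)).isInducing.topologicalKrullDim_le
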